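/- For a finite simple graph $G$, let the domination number $\gamma(G)$ be the minimum cardinality of a set $S\subseteq V(G)$ such that every vertex not in $S$ has a neighbour in $S$. Define four graphs of order $14$ as follows. - $G_{14.1}$ has vertices $v_1,v_2,x_1,\dots,x_6,y_1,\dots,y_6$. Its edges are those of the three $4$-cycles $x_1y_1x_2y_2x_1$, $x_3y_3x_4y_4x_3$, $x_5y_5x_6y_6x_5$, together with $v_1y_1,v_1y_2,v_1y_3$, $v_2y_4,v_2y_5,v_2y_6$ and $x_1x_6,x_2x_3,x_4x_5$. - $G_{14.2}$ has vertices $v_1,v_2,x_1,\dots,x_6,y_1,\dots,y_6$. Its edges are those of the $4$-cycle $x_1y_1x_2y_2x_1$ and of the $8$-cycle $x_3y_3x_4y_4x_5y_5x_6y_6x_3$, together with $v_1y_1,v_1y_3,v_1y_4$, $v_2y_2,v_2y_5,v_2y_6$ and $x_1x_6,x_2x_4,x_3x_5$. - $G_{14.3}$ has vertices $x_1,\dots,x_7,y_1,\dots,y_7$. Its edges are those of the $7$-cycle $y_1y_2y_3y_4y_5y_6y_7y_1$, together with $x_iy_i$ for $1\le i\le 7$ and $x_1x_2,\ x_6x_7,\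 x_1x_3,\ x_2x_4,\ x_3x_5,\ x_4x_6,\ x_5x_7$. - $P(7,2)$, the generalized Petersen graph, has vertices $u_i,w_i$ for $i\in\mathbb Z/7$ and edges $u_iu_{i+1}$, $u_iw_i$, $w_iw_{i+2}$ for $i\in\mathbb Z/7$. **Theorem.** A finite graph $G$ is a connected cubic (that is, $3$-regular) graph of order $14$ with $\gamma(G)=5$ if and only if it is isomorphic to one of $G_{14.1}$, $G_{14.2}$, $G_{14.3}$, $P(7,2)$. Moreover, these four graphs are pairwise non-isomorphic. Thus, up to isomorphism, there are exactly four connected cubic graphs of order $14$ with domination number $5$. -/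

import Mathlib

/-- `S` dominates `G`: every vertex not in `S` has a neighbour in `S`. -/
def SimpleGraph.IsDominatingSet {V : Type*} (G : SimpleGraph V) (S : Finset V) : Prop :=
  ∀ v, v ∉ S → ∃ w ∈ S, G.Adj v w

/-- The domination number of a finite graph: the minimum cardinality of a dominating set.
(On a finite vertex type the set of all vertices is dominating, so this minimum is attained.) -/
noncomputable def SimpleGraph.dominationNumber {V : Type*} (G : SimpleGraph V) : ℕ :=
  sInf {k : ℕ | ∃ S : Finset V, G.IsDominatingSet S ∧ S.card = k}

/-- The (simple, undirected) graph on `Fin 14` whose edges are the listed pairs. -/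
def graphOfPairs (E : List (Fin 14 × Fin 14)) : SimpleGraph (Fin 14) :=
  SimpleGraph.fromRel fun a b => (a, b) ∈ E

/-- The graph `G_{14.1}` with vertices `v₁ = 0`, `xᵢ = i`, `yᵢ = 6 + i` (`1 ≤ i ≤ 6`), `v₂ = 13`:
three disjoint 4-cycles `x₁y₁x₂y₂`, `x₃y₃x₄y₄`, `x₅y₅x₆y₆`, with `v₁` joined to `y₁, y₂, y₃`,
with `v₂` joined to `y₄, y₅, y₆`, and the edges `x₁x₆`, `x₂x₃`, `x₄x₅`. -/
def graphG141 : SimpleGraph (Fin 14) := graphOfPairs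
  [(1, 7), (7, 2), (2, 8), (8, 1),
   (3, 9), (9, 4), (4, 10), (10, 3),
   (5, 11), (11, 6), (6, 12), (12, 5),
   (0, 7), (0, 8), (0, 9),
   (13, 10), (13, 11), (13, 12),
   (1, 6), (2, 3), (4, 5)]

/-- The graph `G_{14.2}` with vertices `v₁ = 0`, `xᵢ = i`, `yᵢ = 6 + i` (`1 ≤ i ≤ 6`), `v₂ = 13`:
a 4-cycle `x₁y₁x₂y₂` and a disjoint 8-cycle `x₃y₃x₄y₄x₅y₅x₆y₆`, with `v₁` joined to
`y₁, y₃, y₄`, with `v₂` joined to `y₂, y₅, y₆`, and the edges `x₁x₆`, `x₂x₄`, `x₃x₅`. -/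
def graphG142 : SimpleGraph (Fin 14) := graphOfPairs
  [(1, 7), (7, 2), (2, 8), (8, 1),
   (3, 9), (9, 4), (4, 10), (10, 5), (5, 11), (11, 6), (6, 12), (12, 3),
   (0, 7), (0, 9), (0, 10),
   (13, 8), (13, 11), (13, 12),
   (1, 6), (2, 4), (3, 5)]

/-- The graph `G_{14.3}` with vertices `xᵢ = i - 1`, `yᵢ = 6 + i` (`1 ≤ i ≤ 7`):
the 7-cycle `y₁y₂y₃y₄y₅y₆y₇`, the seven edges `xᵢyᵢ`, and the edges
`x₁x₂`, `x₆x₇`, `x₁x₃`, `x₂x₄`, `x₃x₅`, `x₄x₆`, `x₅x₇`. -/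
def graphG143 : SimpleGraph (Fin 14) := graphOfPairs
  [(7, 8), (8, 9), (9, 10), (10, 11), (11, 12), (12, 13), (13, 7),
   (0, 7), (1, 8), (2, 9), (3, 10), (4, 11), (5, 12), (6, 13),
   (0, 1), (5, 6),
   (0, 2), (1, 3), (2, 4), (3, 5), (4, 6)]

/-- The generalized Petersen graph `P(n, k)`: outer vertices `uᵢ = inl i` and inner vertices
`wᵢ = inr i` for `i ∈ ℤ/n`, with edges `uᵢuᵢ₊₁`, `uᵢwᵢ` and `wᵢwᵢ₊ₖ`. -/
def generalizedPetersen (n k : ℕ) : SimpleGraph (ZMod n ⊕ ZMod n) :=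
  SimpleGraph.fromRel fun a b => ∃ i : ZMod n,
    (a = Sum.inl i ∧ b = Sum.inl (i + 1)) ∨
    (a = Sum.inl i ∧ b = Sum.inr i) ∨
    (a = Sum.inr i ∧ b = Sum.inr (i + k))

/-! The classification is an exhaustive case analysis with symmetry breaking, run inside the kernel.
A state is a partially known graph on labels 0 to 13: a relation `A` of known adjacencies (with the
diagonal) and a relation `N` of decided pairs, so that a pair in `N` but not in `A` is a non-edge. A
vertex with fewer than three known neighbours must have a further one, and the search branches over
its label. A vertex with three known neighbours has all its remaining pairs decided.

A branch ends in one of three ways. A proper nonempty set of labels is closed under adjacency,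
against connectedness. Four closed neighbourhoods in `A` already cover everything, against γ ≥ 5;
edges added later cannot undo this, so the test applies to partial graphs. Or `A` contains a
relabelled target, and since both graphs are cubic of the same order the graph is that target.

Two devices keep the tree small. If exchanging two labels preserves the state, only one of them need
be tried as a new neighbour (`Inv.swap`, `Inv.exclude_twins`). And the graphs are split by short
cycles: those with a triangle start from one; those without a triangle but with a 4-cycle start from
that 4-cycle, and edges closing triangles are forbidden; the others start from no edge, with
triangles and 4-cycles forbidden.

The numerals below only say where to branch and how each leaf ends. `search_sound` holds for every
such list, so nothing about their origin has to be trusted; the three evaluations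
`closes_girthFive`, `closes_square` and `closes_triangle` then give `exists_iso_target`.

The converse consists of direct checks on four explicit graphs. They are told apart by the number of
vertices on a 4-cycle: 14, 12, 8 and 0. -/

namespace CubicSearch

/-! ### Partial graphs as numbers, and the certificate-driven search -/

/-- The edges of a copy of `P(7,2)` on `Fin 14`, with `uᵢ = i` and `wᵢ = 7 + i`. -/
def pairsPetersen : List (Fin 14 × Fin 14) :=
  [(0, 1), (1, 2), (2, 3), (3, 4), (4, 5), (5, 6), (6, 0),
   (0, 7), (1, 8), (2, 9), (3, 10), (4, 11), (5, 12), (6, 13),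
   (7, 9), (8, 10), (9, 11), (10, 12), (11, 13), (12, 7), (13, 8)]

/-- This list and the next two repeat those inside `graphG141`, `graphG142` and `graphG143`, so that
each of these graphs is `graphOfPairs` of a named list by definition. -/
def pairsG141 : List (Fin 14 × Fin 14) :=
  [(1, 7), (7, 2), (2, 8), (8, 1),
   (3, 9), (9, 4), (4, 10), (10, 3),
   (5, 11), (11, 6), (6, 12), (12, 5),
   (0, 7), (0, 8), (0, 9),
   (13, 10), (13, 11), (13, 12),
   (1, 6), (2, 3), (4, 5)]

def pairsG142 : List (Fin 14 × Fin 14) :=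
  [(1, 7), (7, 2), (2, 8), (8, 1),
   (3, 9), (9, 4), (4, 10), (10, 5), (5, 11), (11, 6), (6, 12), (12, 3),
   (0, 7), (0, 9), (0, 10),
   (13, 8), (13, 11), (13, 12),
   (1, 6), (2, 4), (3, 5)]

def pairsG143 : List (Fin 14 × Fin 14) :=
  [(7, 8), (8, 9), (9, 10), (10, 11), (11, 12), (12, 13), (13, 7),
   (0, 7), (1, 8), (2, 9), (3, 10), (4, 11), (5, 12), (6, 13),
   (0, 1), (5, 6),
   (0, 2), (1, 3), (2, 4), (3, 5), (4, 6)]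

/-- The edge list of the `t`-th of the four target graphs. -/
def targetPairs (t : ℕ) : List (Fin 14 × Fin 14) :=
  match t with
  | 0 => pairsG141
  | 1 => pairsG142
  | 2 => pairsG143
  | _ => pairsPetersen

/-- Boolean choice, in the form that the kernel reduces fastest. -/
@[reducible] noncomputable def sel {α : Type} (b : Bool) (t e : α) : α := Bool.rec e t b

/-- Evaluate `n` to a literal before passing it on. -/
noncomputable def force {α : Type} (n : ℕ) (k : ℕ → α) : α :=
  Nat.rec (k 0) (fun m _ => k (Nat.succ m)) n

/-- A relation on `{0, …, 13}` is stored as a number: the pair `(i, j)` is bit `16 i + j + 64`. -/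
def pos (i j : ℕ) : ℕ := Nat.add (Nat.mul 16 i) (Nat.add j 64)

def row (M i : ℕ) : ℕ := Nat.land (Nat.shiftRight M (pos i 0)) 16383

/-- Change the 64 lowest bits, which have no meaning, to a checksum. The kernel hashes a literal
by its lowest bits, and becomes slow when many literals agree there. -/
noncomputable def stir (M : ℕ) : ℕ := force M fun M' => Nat.xor M' (Nat.mod M' 2147483647)

/-- Add the pairs `(i, j)` and `(j, i)`. -/
def setPair (M i j : ℕ) : ℕ :=
  Nat.lor M (Nat.lor (Nat.shiftLeft 1 (pos i j)) (Nat.shiftLeft 1 (pos j i)))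

/-- Remove the lowest one-bit. -/
def clearLow (x : ℕ) : ℕ := Nat.land x (Nat.pred x)

/-- Whether `x` has at most three one-bits. -/
def atMostThree (x : ℕ) : Bool := Nat.beq (clearLow (clearLow (clearLow x))) 0

/-- All the pairs with first entry `0`, and all those with second entry `0`. -/
def fullRow : ℕ := 16383
def fullCol : ℕ :=
  7588666154112865524611005541265290914785323121955408826435705758650202949087657984

/-- Add all the pairs that contain `i`. -/
def setCross (M i : ℕ) : ℕ :=
  Nat.lor M (Nat.lor (Nat.shiftLeft fullRow (pos i 0)) (Nat.shiftLeft fullCol i))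

/-- If `i` has all its three neighbours in `A`, then all the pairs with `i` are decided. -/
noncomputable def saturate (A N i : ℕ) : ℕ :=
  sel (atMostThree (row A i)) N (setCross N i)

/-- Whether `i` and `j` have the same relations to all the other vertices. -/
noncomputable def twin (A N i j : ℕ) : Bool :=
  force (Nat.lor (Nat.shiftLeft 1 i) (Nat.shiftLeft 1 j)) fun m =>
    Nat.beq (Nat.lor m (Nat.lor (Nat.xor (row A i) (row A j)) (Nat.xor (row N i) (row N j)))) m

/-- Declare `u` non-adjacent to all the vertices from `i` on that are twins of `j`. -/
noncomputable def excludeTwins (A N u j : ℕ) (k : ℕ) : ℕ → ℕ → ℕ :=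
  Nat.rec (fun _ R => R)
    (fun _ ih i R =>
      sel (Nat.testBit N (pos u i)) (ih (Nat.succ i) R)
        (sel (twin A N i j) (force (setPair R u i) fun R' => ih (Nat.succ i) R')
          (ih (Nat.succ i) R))) k

/-- Try all the ways to add an edge at `u`. -/
noncomputable def tryEdges (rec : ℕ → ℕ → List ℕ → Option (List ℕ)) (A u U k : ℕ) :
    ℕ → ℕ → List ℕ → Option (List ℕ) :=
  Nat.rec (fun _ _ c => some c)
    (fun k' ih j N c =>
      sel (Nat.testBit N (pos u j)) (ih (Nat.succ j) N c)
        (sel (Nat.beq (Nat.land U (row A j)) 0)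
          (Option.rec none
            (fun c' => force (stir (excludeTwins A N u j (Nat.succ k') j N)) fun N' =>
              ih (Nat.succ j) N' c')
            (force (stir (setPair A u j)) fun A' =>
              force (stir (saturate A' (saturate A' (setPair N u j) u) j)) fun N' => rec A' N' c))
          (force (stir (setPair N u j)) fun N' => ih (Nat.succ j) N' c))) k

noncomputable def unionRows (A x k : ℕ) : ℕ → ℕ → ℕ :=
  Nat.rec (fun _ R => R)
    (fun _ ih i R =>
      sel (Nat.testBit x i) (ih (Nat.succ i) (Nat.lor R (row A i))) (ih (Nat.succ i) R)) k

/-- A set that meets the closed neighbourhood of `j` only if an edge from `u` to `j` would create a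
triangle (if `girth = 1`), or a triangle or a 4-cycle (if `girth ≥ 2`). -/
noncomputable def nearby (girth A u : ℕ) : ℕ :=
  Nat.rec 0 (fun g _ => Nat.rec (row A u) (fun _ _ => unionRows A (row A u) 14 0 0) g) girth

/-- Whether all the neighbours of the vertices in `m` are in `m`. -/
noncomputable def isComponent (A N m k : ℕ) : ℕ → Bool :=
  Nat.rec (fun _ => true)
    (fun _ ih i =>
      sel (Nat.testBit m i)
        (sel (Nat.beq (Nat.lor m (row A i)) m) (sel (Nat.beq (row N i) 16383) (ih (Nat.succ i)) false)
          false)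
        (ih (Nat.succ i))) k

/-- The `i`-th hexadecimal digit. -/
def digit (p i : ℕ) : ℕ := Nat.land (Nat.shiftRight p (Nat.mul 4 i)) 15

/-- Whether the labels given by the digits 1 to 4 of `n` are a dominating set. -/
noncomputable def isDominated (A n : ℕ) : Bool :=
  Nat.beq (Nat.lor (Nat.lor (row A (digit n 1)) (row A (digit n 2)))
    (Nat.lor (row A (digit n 3)) (row A (digit n 4)))) 16383

/-- Whether the first 14 digits of `p` are the numbers from `0` to `13`. -/
noncomputable def coversAll (p k : ℕ) : ℕ → ℕ → Bool :=
  Nat.rec (fun _ R => Nat.beq R 16383)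
    (fun _ ih i R => ih (Nat.succ i) (Nat.lor R (Nat.shiftLeft 1 (digit p i)))) k

noncomputable def containsTarget (A p : ℕ) (E : List (Fin 14 × Fin 14)) : Bool :=
  List.rec true
    (fun e _ ih => sel (Nat.testBit A (pos (digit p e.1.val) (digit p e.2.val))) ih false) E

/-- The search for cubic graphs on 14 vertices that contain the known adjacencies `A` (with the
diagonal) and no further edge among the decided pairs `N`. It succeeds if all of these graphs are
disconnected, or dominated by four vertices, or targets. The list `c` holds the steps to take, as
sequences of hexadecimal digits, the lowest first, with `0` at the end of a sequence:
* a digit `d` with `1 ≤ d ≤ 14` says to try all the edges at the vertex `d - 1`;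
* `15` and four labels give a dominating set;
* `15, 14` and the four digits of a number give the set of labels of a component;
* `15, 15`, the index of a target and 14 labels give a copy of this target.
The value is the list of the steps that are left. -/
noncomputable def search (girth fuel : ℕ) : ℕ → ℕ → List ℕ → Option (List ℕ) :=
  Nat.rec (fun _ _ _ => none)
    (fun _ rec A N c =>
      List.rec none
        (fun n r _ =>
          force (Nat.land n 15) fun d =>
            sel (Nat.beq d 0) (rec A N r)
              (sel (Nat.beq d 15)
                (force (digit n 1) fun e =>
                  sel (Nat.beq e 14)
                    (force (Nat.shiftRight n 8) fun m' => force (Nat.land m' 65535) fun m =>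
                      sel (Nat.beq m 0) none (sel (Nat.ble 16383 m) none
                        (sel (isComponent A N m 14 0)
                          (force (Nat.shiftRight m' 16) fun n' => some (n' :: r)) none)))
                    (sel (Nat.beq e 15)
                      (force (Nat.shiftRight n 12) fun p =>
                        sel (coversAll p 14 0 0)
                          (sel (containsTarget A p (targetPairs (digit n 2)))
                            (force (Nat.shiftRight p 56) fun n' => some (n' :: r)) none)
                          none)
                      (sel (isDominated A n)
                        (force (Nat.shiftRight n 20) fun n' => some (n' :: r)) none)))
                (force (Nat.pred d) fun u =>
                  sel (atMostThree (row A u))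
                    (force (nearby girth A u) fun U =>
                      force (Nat.shiftRight n 4) fun n' => tryEdges rec A u U 14 0 N (n' :: r))
                    none)))
        c) fuel

/-- The diagonal. -/
def diag : ℕ := 62165878839239376712421380424636362309022389198707151105466211422950348899501817724928

noncomputable def closes (girth A N : ℕ) (c : List ℕ) : Bool :=
  Option.rec false (fun _ => true) (search girth 64 A N c)

end CubicSearch

/-! ### The three certificates -/

namespace CubicSearch

/-- The steps of the search for graphs of girth at least five. -/
def stepsGirthFive : List ℕ :=
  [9721374873968729483160738984756625667345293465490831760063053608773284260364896203420899436651415859688968150782557706057965101457750791168273,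
   6929458644976137438684693746890848744275145762506076024545411462186418508224392926490472086270620298243506235543418861671609604943456476740383,
   9913230667194468029244435718688570750342343680607261614415245993681733936392701285300832615095714081089899346356132134575299759122024957120895,
   2558653190567751522272100775202290431618142371571879410292102007129566471905781268587884154229134010900638612388387435928023896860744968712655,
   4219152162386785054447312472283399763238874992115120307291785450809450801971393373002538901417867063657647877279501131750926111361066710728429,
   19226334668651261464337096555466913446933386389066537459531537447318740421092969478328845223432466994492234720709418198971030610697748291483,
   7499682563358240541250777134817116747888436445540260291881650447692782877570141174248332613909311456093848783459297631855245576063693395227967,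
   29303371915718276472139772634582315229358730763431286168174754977404768346758195964472818678063315102992514676906756589946972515215225218959,
   73207135415145278557817985921008468352653429494363707742008368422841879126787273922325013334075329548030683778196442352071705536013404481743,
   10261664255518108223262805829624835705118717110423910364709178354601946351976177309400511633215377678392358043319874177390790694811687137268863,
   38130504610036138534827376544271642126452952616727051570328030372163398470814939888607409387666770175100797874316772436909335902191603673,
   2119006098851038286191701772367509890865490810961548836689755166438249750580837446845366630442899628058910367459235288293226272986280634463,
   2517665411751979969520731039261672724946451428044002905135825469901727354249366461286745519619831806003010864371224086718844716767264664351,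
   11092468009184570586419413567620204248828620282267713513505278548041533358930376347542652284719274633184094395732942374229451901854343359734575,
   43884183139889715994702672039391820742684386026734683153144521133773207251457033867214418595528940596285090807757499620912587498932762060191,
   10031114332680003487213855215287977326333705752337046633769521890401783141231775546649631058444490845482317975198489728516222968173237474237295,
   2159432589131195163619125820963753637695120173564715569596887104730686025395191551793707640127656719589236891951818670951806410537757834860,
   5270919575070258818189805125609686434648738739728967831407849725641874683832762032133083604268871593215071154664285096451322314088713485908623,
   169569812664419772017707026700584747479871399829404421190654621371094793157897497931959115302408066210179724137754647404103127107517043359,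
   29098240575585987767948874532899603717355399844253895128404421143853465156427414008928678903371393846731564876398630412802722867695790086447,
   263883082099903711689438389698654428646036677241092278902564909512545519543506750315006293004884144939234551572612463980158488871436454967071,
   20905878899450413320481462895032431776457723014183254509257403681625333591810028107380040954645756141039628949899665214859712348256207149615,
   17016744733680785781116401000974072153924729364714107745548218627932998963436919116862679673123774690450377649683309249553210268049485117103,
   3317612587432148318273426359719809193613893780993385615015452449171634937438302122566539955827673981703201492931363903]

/-- The steps of the search for triangle-free graphs with a given 4-cycle. -/
def stepsSquare : List ℕ :=
  [7116799079964700430398621392489114631695945260042752725125479546153139893623302443834581935655376360423414289072004121851551490818531921,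
   8843215304879955471191950232080253260201028911777113298300230801405180528816030171234235199970248649230308675915312795446490425990465450934255,
   4035314466181450922552465117668030292750524057296941723048698188425967505887115482626337007275089916162745841990236471395865853133808512793803,
   149625946586563031244115633384725506548277107589274774954644271621446768287063497962691787819161506805203689868529908795805436263407009742,
   5411859463541490132443068680663121741058098055943455452637640846610910550629911714728271786512801969769686696401636230127910767455585721129855,
   43557853057743264180480869306897218804668202347326233474594332684722330497990249049603599861327652771883419924880532132483025377927572275036,
   2720198838763068485275198529135833998556712807614992419750943711868125114894176072730960613396607891181326848834056738328296534688381630895,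
   1823453514144641438349404378459140368397165927998382885448275183644831546557336107018870814343031550857992012352826968065482655651048594319,
   11352647367096895333656709011882905922498320204120632596639190882295017006522453537336099744038891959344671807852309192347775354975906109063151,
   8875569246745596119547097001377245494630837996694147376243231511798669508921457587074011584577034442349687945061592923252414858088849620867829,
   35240085594731650367063558142780093877842953486763117256716139820561127982279818387926486456948605505673889189441158718597439396288454056063,
   659915221829410179466040694541679505312599467543800869849816843908413343366707726232961210968033130219511590190573823239409265038578625655727,
   10537126302156559985592942105243714120193502261850532936354399604747681672113406371216749439909088411962097846386217454588726602191915109986511,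
   15738457460327285842580757690730120718508484359319500972051279394511124477542908309106920229707837424494161219020405615916033764299785567147,
   555854774317428246748302116548856917012823534097006131084370973122741775357914139011093468717043869144497907370651485591040900906500427050271,
   7136926589220525448891354246980295346367141911408392725831490720342066114918278694745551754471424637250101386258423480434986539618074296062207,
   3146002072844058689183385556144978141665712356240430446692439250120553512854316354402942212914021699633808233998336761822719360504712733071487,
   605196266735467472499159696568988380744917534912806221554555696293489345227463330153569943266075080464350113268738332454973975312675396893337,
   3127838723031812564156891639455786798139083253505113752708747440887560127726433257287375617770055218995457609783499172241763730361428431168431,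
   42091775092274892643599880663363188128609239183403399346072082201942950616979969262052811434284213578059328230785369428748489452568890799870,
   2653401322069800864774200543145990126618775588541046900079641740558584111522804256248958708642897950740523545240034880631336860169120547743,
   512203459838008586172490077864102746142279489843392466330565784414395216682522596125301358315623920988153730745053718352284993362188303,
   161117984301338198863996361716188130446448681016717560402499466534276562046393481615237776932587154643961576663217985252047077147256685055,
   7116349805963239674818527174369849968496332396152609721614334584732991054411009547135062936985486305280702075454063796915600709558340015,
   8217263558995969513817856731867250787951871992773542483528515296833274444940702134069570879286854457348384794405245920936453287269935315156975,
   170727909291920268362627676837824424077431922841715272330975621233996247692382632484139400123396504666232585827397991273598327750604619759,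
   5559047854164399913888551667955932884309529159360806898684007686571794449965418754335243624436280668336017020746083028392484335052268327209887,
   48400099209311113579341358071550661589489648148218267299517512893122228807313370425854919366491045972192830971687207112857142880833526815,
   41975707580924105481890422022633104993118196075584245088029401783637109850938501568917235227261606905009219802879347139058485008699763245455,
   1558893009818981099279053679568058978298056311238921977755740458782392024413565642048243099338215972302012438692611720979802468537916583020399,
   7845105193545735070299211163582729799005834300430658503589308712474327316293859082367542910086592570033321229290937302428950811487829502558415,
   262797387136594029959782828432599797958902095951697251790685689107832437202882278923156147468967372594456828329194274550477308200510653711,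
   5363853947381466067565567601801329782155143915881970253394369660673656772266977203436691278110490852869697718500356194360920865596620530666143,
   561271222171278265877684811299186169932105639314184274012093929784019045546884820379354181234073088160990039389188877209922851461595173538743,
   6393761025137316444724340244836006035644089520823526304607423015246008452411080885596899343606713222139962040210784263903649689699815426883567,
   609509691763228170392408611373246639842472951021283674958672287905613189236440353445679791662110268466137676058703484279239756356404439508415,
   59319667388373101505718842124102308340725489171627950506506466282061615623800715308151274967779449918161242982101739108020375834068414655,
   9701608593951514026882864359325316299061884802043945485463045118814934228116106299098292849916933304097680742942706669356781872864504565799343,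
   38171108177875157800773351692692047001434571437772832581641124588382542411335836365252440109628464209883747209370230954844646189177131633660,
   11355402113333875066396851930421906618401865442262163813871192515650069110121895701624127948233907644842264996914039802781527265038341881531279,
   3072725068532607661344134538712154775593089571676523183797398183817078055288580482873122871140177852251281717379428663003409959956464264775231,
   38067771465388110603120911740172532507209204518006350602694162868670792186682819527875324978781617989008072369522537814461422131032724602059,
   5364225649085896763005021196642247709952433084507495313778073880429514012727659610608103558945503946772543023427377642026654192155885824450751,
   57076847288911493686636056464075220479272740565267599341519874189877704736350459885591572527044550246255126540790920544890419788675353596,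
   8893774116307248048479545721809310402568636868065080940052138065326171854083086596010640224617387532869461945564450634976838721221677210212511,
   611621566734745963538055513694109820761542922469716007010296548420278330487248884990039951517408045707694100407911474912198014032181165342668,
   11361354922485937317392735665689292286935651422174943683087342552384963601815600808456328439560956608680370413361656025966331640467871514430319,
   950477570466097352183959079419832723174245709918178171509304541297449867978048850449334448160093572305359445996922664770006854473367644223,
   40247330167814716349745558536191014975725692590041100226012423643090779292562093467336263788354013446683658859906638903718135162634485732303,
   65585781731991953979022279734469260567834492752530305538901700201348688742142378697678996522081649435347681216357157688932230425268936911,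
   41438655866345728101237471867977076069149675203158887400025896643678842813741347114325477686066832643952702244471762097188472479044075164991,
   42652756210761766818931092872780926196482442599703794413411819637246328282921475129802551206341858674926897814702215464416990616454452511775,
   131383903876956861340902318169070269992143321429831001942156613482634150615589722791531081524065281173294577366433654285101141557564134927,
   263569661978415850726269185065877494888114295820679297487812709826505508586704979125391245640191299827061390631601796753700258460772705231,
   36740105120933927293866030918939697483908016812037210748942884931761143215787881527024728344555304840917827606292242630634129299513915100079,
   7836415756495043717876452392560875238082617372825693679454975128439893528655905833657544793142258240880121140674317337206445414114737023,
   143348523275149557113917972343417238718818911060087026240169373624144218188805669020972251217433259451090615878908648130755251191277420527,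
   2616619225712201896700970316207849738700763274574207399971744615178931453926205694162383937267727953594440379732964592304026933016747594687,
   568055750278001038574292726140078370040438388069560674098725631994462067392056473671409200288898742592556667349250217929962189897673213287311,
   2021163266457229042311809514834430259563510324022488842836080688989082314279033151861561727944167899340807367693701808502664816474977751999,
   19195878627284487674349115768705449603706662042912245679972638864905243940715581899691631249967624905893223133765472257772342840579925199,
   3889992926500996565897074774839423203781584124392777665370323508264468364829248298548071914656268726986014959874686008741045373633338142861663,
   7107710351040184430773323181351744336373794208120538819053745036086081841635654887496342149064807624008997811752788680844495163018351549078942,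
   49797086663269643022674091745118686815837405184867095222235225188638404431609072961454239407059006054287909184705302285563813524648652057423,
   10717672354157369216781205912472956024822313954466024323272882591953401972658232961648006652230325888646818671878864497805185094913600369604815,
   2616619226406960275784832914103823689758010983583243881988671967832988156738126028544089829201090911994041550743864205005976894529801243567,
   22635714540476406381916091546895674222770295645476702581344831727431970175727770965859907855598768346539639699427582057489098265209184783007,
   3892970507762451883003912957959892338080097954628684389308989121858190605098378369556041143694998845772435020331203393163397466538762856079759,
   762133729791433267279778113751616494425372549021747385107158304369866613784879656496656108890573888224946396093686410163812436064585389424590,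
   9825030821390466074412829391395059485087035159439171954599419413854580258714257630838004478988624544264690403221788756150363294081972166572286,
   11056217057038609772526905595216760083588326523794547725465576294650132681083207646964278875332037456977016074974878542739973750161311682248606,
   36405488808636214919527697966120526451376941276964106457969163072782015344961467037533631369764207141632179107311904475286200425399548655351,
   55714024674183220685570559721722679427969207018139073847711832515793528245091897277562508253397041661529584907451189812856157606765101423,
   163538701636676376858027544186039477508445784452410663743947300425258465774966214682672413479123665650042451123441123286261410935862198255,
   55124219428581494388615469261376638458413771945047850642914350536221742672774981795870442975860432589227422173192376259141970978531658655,
   44029344786404845229338913149668251305398856270133082362557170850830415847154255519547057920481230021782000426819644498314914714077409842847,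
   658132110431768330703039187785548970291321162480080306255548898156891171267764284637955020549906825321538324861316132834910891731525714612927,
   25936508180385477543820693954563026179825827335766300128277929289927782221979343414832250277000248487614372341172139459859907116498056540367,
   385805931976846787916001978623748757391347560824378981052740675777799999596982020808631827807402379521133538302606121245559678854001335973071,
   44391462084195616603959751446482405800348827569449084597640752677188657614166423235110955507777028060900754077037764927789228975366597756063,
   50752360093455168658095908100541946311508881065345712544983451109106164614530574986184643148007229786526685730271793913396505664042910399,
   9195532628332783510046994591318368487607314447615178404377604161660681004370790099277079141772829700537685008778008145435863193788773047576943,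
   163061188007161522926750403925903806463994945586950638464495091047672344019771717207727813252914762213533498195281195114276632606147907070,
   2835530753252514362333558659003700209959580515856246526209391040389003263622544152227052932741048832721624422652177614818265831221150111459679,
   592704715747004785971559114917258909653477124246534849015916685242794039845042580105272685189538547895596326608957418720455605251477171390462,
   576487233626913198720301967698233229665319576445427620133329564431885943430203121876927443904691467172352196657010195732208818271,
   8981300435458471941328831534002403733923260798814315904276625024732226688244400774402221233422542909266403254773779530765508746591553122743039,
   699326226139767521443233225557751429799324672099479572546036207934220470259804471295288230900607505495755665720726500468160061090758786431996,
   9623572969681902048700858213220227966433751356768304849308737520154294038470975804744685816706267143315792855729407518034612970579312394331039,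
   28028345534922443630369228288336070154043314172175656496710953632252260178089396891555826194671375289001284827589401600545400116328075299838,
   902142483028326783495028546076973608856670536335307674569462262398771420668912088822043787823827897210620770699298786832020094586508282751,
   41415352773058229453968735291903966210412128243722977351217482976891861025641178698195285216295444861120341810149747660796485951389555273855,
   34974492174055764738287921240218708836112414302209553097944706621147647297693913521385517005865863617170702541453207609617843519,
   34736280038480340393408892201058792961019554952926911144377445112278633339299498493074269592543283623989224569788247506760507647,
   8670892838856868655889499900750030733902117776116049890259763756481417675622769747453170293893641919217020384828091825297010656606830870610175,
   132647361192085537034991984649684196487403413293128344984588873676795670992230031594817499636679747747589844390237847731414792607407736447,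
   435929793919]

/-- The steps of the search for graphs with a given triangle. -/
def stepsTriangle : List ℕ :=
  [2738185311291804732130928962840731865360147030515342622175473000621553359389731195589154072523864741268218511976855921301744324306184106817,
   34295501837881927439577563486250935936338762920685184400917878039353731841067620160158191991642395329263736836594530697395652866005721745839,
   10494545212973445593590220831153845850420923813365337115148293109902772459182930893311653626740970880002498184806628782951820429639770790952943,
   2651947730208573105413268240598711635820806456236601411956868274030978187348985810462232479581454348304944876599204199137237840611748403193,
   6881220435775138980108351468767166411831319785656089934661291130559337573692615977431498461544444610461374964508066008396833728755847226789263,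
   9752251967498630310341848441465838842434371814630559064746195012631552785376573475387397491475992341024740307739739431812316708632935994658793,
   3847748323768756584485622601919490536956590593934927774705360294648234487694891772699748385484673871522252526758520639734201638029514960879807,
   3229062994213565734740658251374661400252400269250555301955168210527661702397001062176083796976128709786966246474041862692750419963932009613565,
   598866376684104132851758039100487190845690833470180650898591912640846930246867325120131079172942679154343136114452929959470039080196562500767,
   2610461136957745148318066280192420956544236808684439993063503773256244474444602334096316949623581567072808267909772338342472181901862176447,
   55691846723985380975503484581300238017606536287063212193512888945264767996922346561624582649552450686424291061614252728802325729819022223,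
   38093410353020517211055569099067462561131254130073881907479868607306354004386255581507027620315501605695566942987058547140782752869026647199,
   693739179204649063129128060749402281415427726053856513344315521417150130245296540312379624998845755229950840381801696983370625025481455911103,
   5465081515598552226219884381832517490216677867890585270418874221367531763663996653023426347221264307156440948492497965036881867180659243526239,
   4162118614623502137010830521350169770794796057410719864048372070750317024308539467820125591841317349762042050783109307545258593232619215,
   669854521353213490516799014392852795747453366569649319343578098642748785202969649282307004200756587629238008351187152936641930171008084380783,
   40249332053146780703558252217196966191843902275143492443758598882851865498043984086725416370163303693761220391251842894772206292507790084975,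
   10688936715772275662189669835944088302285592460589704170593767002549464706828521281888687944332748947097191381369029007118712676497190125869647,
   2592272339710559786183715287169463120929168438038079058545349675541414116675319926907987951916081744628059742187555808603524211854976013566,
   6554241304011917727011810211740907814698492715303040604103312364554132598473041517556240805274841458094996335519108838076173763159576961656943,
   637251453681079205715360625239928888157487503589193927494553950619060829483050253492597206166739819828792875152352932588059278592276823002299,
   10698774620467928505826464045805980077957992073626937800288604454372024733246987105269838598484192418499384543502434484929262858713399798602895,
   658885526632005303540465877853222934142567687495999242790164357546138756014392835044580537123134344717081064405928339176281719698015705361838,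
   165110749248692562234428762314743906762662294246668134406663699181871146726346245471710797717898432795210234827956924983007722320753396879,
   669854522088368479515820310240313240467118175042466365932272271556626643029017067785523532490095021223242538491559417074771916204943221460319,
   240682188911635672563357352222015473134505272678655252958605532349650677782964853851751386189806554349911888923771774813297901186011463101359,
   2664303988481152374158090435334661542741661653675562592525149316230284487216945640249248669668577387787256128996891269806966324911389609343,
   1445749473255377439980779991513272732026458561916478815279225058556919876737861976263780877542450623451664440744924320767891917671625989519,
   1230663768277346313290428833522850660171206625649098008987909277062652799703491065336842994860707232014096875562094369614028408872386190901231,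
   1358678015707208623685991435507014508571020661104490656586767676794964284810745790875212810631928952068212401910473824178482880912529421351007,
   5527786425324358216874478506035949138518496793053650803735203942674413782308858095550669506829945463271723740327611387090460335980860913217400,
   7347682428342948489178306698064218516290846272094069035713182234961483548036280492315061497082533902137660582982059412164090588759951001890795,
   43729434973143998876731182555048516234300617826153471953705052098436737505554077004380224217779889697339440649275439427839758859002707951,
   163538701650122144068446421866043783355555730586438323999567962023604322778664221213260905636546753204227578883628194589470358404903152799,
   3675267496850995512141774735212367628017649696952422776001496355548115119317490136001209343272636568810603995471712894750730346274199549709215,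
   8982572403300113457187820745906894811099825574827127573952242193105774395495220452355905071393087847685689152669120276853201721180715245799577,
   85103731326821802905373367358616872561641959751985554496294287109140612807285151182764686394298804269430013985168211940208492918962624921583,
   8681454612778452878035930259911327564279863555432381040250764286841066244602142459377397482786924117188566011185880024358932132007627784833375,
   11212629903636517376981438896795398092495998100003224289654959613718908038667013293835177020828632902978122357987993906523267593451811067960062,
   163538701692831823212319846754612345028193607500433939411222589055438062184229179392184354192879391004633188167224428019232586147677145519,
   171185026025189035979548742187146703499310455771077007202541245746679885443141278032683041985639452275327563628295767418929819350625291183,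
   2616619227081290287784915488873339205534626842356605639065746335357541236559270495994168117673803782427084603172491900367133204689667196079,
   446000442389226737933635138873835804340847855401888450818948433174751308791928433397240333776281361593947514589664923319120126708906498329519,
   2455828942896098941717379151462019248893533494751865732938040314394927633461906999175886857680111825833276092598922032362955937633755824110,
   9052101034346087063003348582824876744445597048986382684479077641324775658919545033238414616971193772154414912967869442758581312887807693687951,
   99420896805265894259859491678683274768197001313977745410646083734247187250275540973821776265798666252913885524863807171236329725962447614,
   2621451736607828030277666801073374195980483663767254669888501257557581037602283891363825316799435991655934315323073682791367985334624190447,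
   170143733262971074165763166485810259150222523832642461708879155250011759957795405055031466360811972655637803713495112365588721063209536879,
   34443703319551786376622890954151198638905039533505780334633278616123148555080417293227604146298398521443902707110373105446484565576103581343,
   28136562798261115930860927629168929087910315986113668135870261657909905335038011486543344707803403173303891035987158015580381750728170079,
   5204171801339190812751170250261897193412183133706218313243238364452764288355843806546659504970125986189814653360176519905116517777282622858943,
   560678121772210611357600364491151477427420908132212285441750212100478707344187172640868908579986525667205463695438846615457136423092990224789,
   85103549617140729003650730027664900560508371339559585141882640695396429106905244403233742937330276658196058306918415813810743094775674568687,
   9703697496166645005870966051962947944751927381072058281208447064845700661453225586683670584100368410623480491610699020413272696356022111029599,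
   44220179120823123558998070819142958760278776413226160558889709211186358459002955991196140559111284638579173008041282677193972459968857050108,
   39034417825612611574933943331710138345001077588010170114402495462686756306125162936145940433696509688425546295598611766285042143744086804383,
   1037704999099363462337481407152709102452565557497128883052571333219948424114356662723876967670472870624613479298240445542588428032918183939167,
   1159963993626020542486830427742329278592566990590718358248161318114220604303182277094878470484358149438332770634818117313911995932335353081835,
   36488619954195561068946003561476911514039959419108569396326170524866059955981351707586501412691269953518668639037820168576509231177862575614,
   170492801032369019892325553622207009044324026710478198549152492468216203033761676827200292694585902591583930779331589050905170426777191359,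
   978544932209739013067409655758919421808210332950180442235380372280043195979816645884374017142237336310232295188344523131835548949644683185055,
   81967942259384582546233477575127955470061220337125677648873333543075859683380277492432812071552626252320946343274139729513925199886335726,
   669854521956304562805760874089595161196168559999037226606581257513242048818553345761860761011359705215021499351185775923565156936840452872783,
   155579503319935592838367069132824111577085004145617454156817781088637466575046838688337941666456382334676521926378793934813748464960347039,
   3872607684640686148091232272282983182639388129888427649502692469867996795269438119336249149338985550325026376764922196000354939116852967119935,
   320808104604266439785318091782170151092177021286623768201200164670855641972428833390853591357692235596632608756758745823076061303359401916,
   42816822674875462493066100970756719953347305141559101854978942391190048531612212299815722352177113638816736644368726976996052530562218443919,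
   609515775946324965516419376298088799022052185677306982643111435917057516081741127457491058732413234111934788863079267322472887456540788898111,
   10259345940569948359715765267400028381023057334700201154957959591110516803589305897012543382027172687118075543348824642571913740604910247362751,
   20223764376055691040601336730576216200659459838028044784674410008966784329612839277151056685527487768101968513767750159143600878080336264141,
   11338655747036439477236987911316861667375447965778029905365693696600430062389272753943970735046124305906185778841088514601104827041260820758511,
   1296911496159101273128567198595391110524430315022694852124933153558976013219507997084319267102851127820034251901341764162157460593087314184271,
   11228734707698899308979909206801717225902412132090139819415391768498183219086339322107209190313789149159049020295678582809968370639477199192975,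
   192338427145600935543773499093414759873116970923005834557257633106564893170425727859059200212868400454642296699214464088986213845928440283086,
   776716004017727199201898102256042955071831461865530690192304876284997986326677778262595100151197921151019864569767681087898748752269412783,
   36301821681330699052021605590840701838069711719816511660790384525991957095743981610363080085748956883312691364154846273033446152146288651423,
   1494151670530983243812614961529087534943634227972127479169719350925365917729869600351961229628202644659627552241803123047503274387431491519,
   682061821088252871119284211176224959817358457577485592023221209098453656199344584321989030130107137394514112881033504100738017016970355607471,
   10399277023801355343427052101233851526317341202245979203318616800123227146670437525699280250721517306663743893388890528300385989552796194905503,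
   160860713192836854952286032601888466324469961627039160692536148416776240843783582714194813958942093402891880434258419201695264996391934462,
   117166345222619593181608773010512748113056187710520336676062974241614726211217010947502070538287655887854487315969411690293944095300126051455,
   11209652772222178676065985243026852934341298882760101102130849185991951007470218417154106668617004832444347549945127172276340951396628572486063,
   2641045149257493074108475731494711072885603547346320272163740739912309011340756502380729508747827023108343161797702950691690048834620557743,
   4040524407941743562563721199480429258935249214376788294552279261596355483692833900195284177697457408222766898606865623317707765186505365523839,
   165065321831639463036279398025200277657883624206192178812257214614744833707444569208809976156621288070341692613235813727217089630290365363,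
   2380050570937864661027521114491554163306885909056961722721533410790830679447195232135883226365184950690954724076269577657379678997833977231,
   1496787776536034864491674462402422112807018032883524498163275761066313800338310506459690461134429708837790166808900292752954080159252955327,
   9253378298027945097451761920455093683097154676107160150111585491391888460170775357161705156820380305606325016948860272479777984152684988367,
   152967076488417592854335530991245206779210079957892939369244431760236532777959931922604503746770527694453709574874158054062814515964494543,
   751321981037503657029941281748006022053595471139729896199182389794369231970998215692004037588426118100929228050994142968149698776692475215,
   776716004017716704938393557059534593416316309169046149317075203798818088483713006970201439388207365843277292278789858791562187176284522927,
   36848404402000995433714697094372482396891609267360897930005865991345512689991045048888118415876420097709397641057630171005247712586252954783,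
   1504327767578236804449935949439285712487265083320721156683393693695081591238125160594770012951507265541334710652347276960059648120704992703,
   228112941060459188673423058169241532996042864221059824259591561797242234400593003595123060501345527059702582162412213091039631312536995567023,
   513975542989817179273649717833591428542712964824518553071878010558020558870398637500558678246731982673195750643683187872314463634938003475615,
   2637896455911881577790303506187210563979392267238316718066970414881318142594054342249323292378234019638459345580242586413728209124927209455,
   163538701692927015272305794492326622232617236509686170135137998691127826743061118484472394071211568532583907280335914886647337656495821919,
   3074811303877810629695030309663629371312975046384114777164633042720420184906531714774102121956447758277098607418262600245633125298075974646703,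
   8847504880466496019827852773527243863829473899798214632303029887906125815735021918800318099839629559694600402842788438778325588165794652761084,
   11065101921400337932048778712882638311563597772380371340603106636811431167131346457079379678895514500563609802141592246726383845745191970455500,
   592563242619709454212414922113292854181161463555539910114639810157226443406316752148152512564368189780543298735104696188008078090431715675132,
   2580435612745723802025719649148091137023785221986260523993861530462742374680555479488625005129988636627847886250362314307759724440380187583,
   10694716216357455990111542402924737918818470904226079279849173698903030321837336932411658064564974656969914834550279661868684798735242975600847,
   18006696375737983931162820346778261799970439292917862764608107867788375169621857020515509383173694126238981848392457562275264122979913388286,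
   3833979086903893472381354703719413899144291348887104482611270867181498689615052816667232538089838097647040687774412572855579505387159875143519,
   164820608766934095861627998866586712202372172615426829611274861301169477231053297047627270720134780270392019284290533041886034320596483068,
   10717672350120839734632963555755588668704367675356184191891341139425426699683750257255820374586536580752139992558239902516391181878324929176735,
   1846928288889301300959582662341178387532650124276154884924311238751275382648212994474071165464412367023296356196842614232440583042303582800543,
   43823321238983311142761135082839741547746820257316215426099859464551173291869722481217159603509178962311077461631930423226716098219098202092,
   11188638192641867032049703823559988731552335730777739763436692282248721549124066957261046772018162649206861717823522672923367223832227017333167,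
   437950094994252488930382700310669619252826001623256846672401232218704408325209717053991338472636572563432395964526976450272169354876880624543,
   2380897233450110346477141326645286356730785454215963993202387229147312365866877579771709614955886689923397858331856546097345218364125153935,
   5375395751441914426852767194236760718188310787731473681890171234480161292875681313576343530414819392342953962559933326005677659001544060211391,
   2380926366887814226923412947234840870287580169583857991928489775809677602170971987022623476436532011765410279666924567593635514614753910154,
   1922480159357167686436702937427231653997869768097695546085764798226765413205928520422128069951816731504402019094753497332293672337076276179135,
   32199299008182535666863996808307594056115897723188658214570279619838594586645991352875608699462293235805367593160727099391448591069050031285,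
   388957318634289301118429097301622102420244841734202047636042128179183944903284293339919754016272804852620963431396128054358231991046242355839,
   8284502592937889671341412291930085532495286282269787208645158542636120735477066525713761504950096524394501885045063484623199839187314591839,
   6291680404561501063947258635524278374627346795676357856903127859238358904736031425661857520657299113167897514154320266065514319809005663,
   38069865875604345812970489832482559206849904651204327882211124935485398138489621337493878696288665966265521660808507031387196499133205624671,
   432554043704797367309601405730427261586962933097491928588745763345422860563886686340425706862527151722453642696669818758617174891483408797887,
   10341768054720515785185392390732384509486579442119940641555255088027974617787876829216497504983542730131827829448006062955368472257884920498351,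
   4784014413130731493770595230239277133693299765607773373571573312648530775518055229187801355614422663536002403036578370047966197862323815934,
   8250302833412306961349350106508247523476559074777394007446530533452544161500957873422991093578932863184363434483718311381770108481188300639,
   658199434059103932500268995779765798313197021281347255914401243915047307886506221558185636620622257085658436519544523071917288117471466793839,
   2737503899987777600670477800897982178513896891311290144984182529194813416287003596707525657342466439583886409204907298101004073226963739599,
   5527786425231945145750294803748443342056984140927855094033481722826035342837892680506032483046476387890601774630541935761938185285724552038831,
   41865907633532823227743254141879838878693676638247852282637589557992471609359738022657680208053298669487077409501170535150169783657988468715,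
   11338494371797602014800820345024098324029390933780924751213746063754826361703683193629732666119093038941419342045196928899114976067808401951663,
   8327278147452915147671701116040820342043884390594971368047216855699947523273533518432849424745317486263330243405728413562606532398252661527183,
   10957646108016647686908996912168730564859979717019811914482800967353248787314463370284144848383606335148572039850911477306056587273143422405199,
   669854522057167312850528651686792382702291093818247360576273417000456420996663421040770701310868658707318530030360767870658263997632884313487,
   383549472310183237222074949475907562082979441324694155374383278246339799845277631174152293561346079456078534226806787460635232703403596843951,
   136481069531209925346120014932684890100284082366212367183449517622975650553873125138714053395237040613491464038298665752207076879546977615,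
   106498796706041722567527792238869244115505952915970681338538083591385486671633419945995134642424184413032648368411723026431061984344539119,
   4917474093189983440731205368564860865640817427338186004380084585734816626823903809504098996685657841576157427932639152445759278842736266651743,
   163976650939680021374516274979257343588525541748915273373194295709585347239058000293806794659019464404440840313206593144926612144426839909,
   8461936425935826292746238019255515109061908502198913147038276380931429516290150890821489432918963350115707933820774390236184364780507635046463,
   162025704540224549487667243885405809966699160232415599377923446958613104608852591107502003148217972419195957136537979315441770111416242158,
   609509691763182490681872368550294422636191021247088302281954799976819530928476548285117109861785819729302414709207463487125585642847099590751,
   2380702040864794705545087598634873823532405400010114008155528748148304123291539916908989519495993356407154538633422232825519711878750159039,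
   6232484979122634570339875596847639534385307214300990696053861231444045299204165280579202959010923916119110623140269999201757082335854357659839,
   1350863054270282698450706525667319424956136021575508673108157960245343818209691036132689627056679325112895702102990371932404806927097022766441,
   700963810271130044401442110002322467517726446475447879897078172263304108818124499730457505034316284516348679839675194590401534105408553203151,
   2686790561467847832782423798527091153845928593577926577955361745247156105463902159755348405217006399681285606321837866746332157277655795887,
   43459541232914250799770062277923404801362383831161685005934995087304379206100163512752844946450717548527323163879630875483015951613479427407,
   164142576875237988633044006414700280193996348452567184193702166127547543116635789799311287736979200983343609853376820550796668518813404047,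
   2668258488894930959352622164125993968896378125531383576564899412663692291491949858509589570396341240030467648934939095441363384455169955151,
   6893729577996845009105413429759743268699186405540044614436458410007950603354340579370438320750959261138851376490048998211728006457887940807503,
   41181793413565219114361711986522578781689231832087461609566650645706293178498439937815144997713810678793977921490237380783299270419810399375,
   117143080726502778437276369357598677558711184476740059774935577824512065768676234559549082487985538643757360490296824875511377078979046747247,
   7655878473248746016427347909199814665093870543507118197930931464420326866370797702957244633610905708519893059633381191633942115851941796001679,
   70307429018565187334312826776221318279482644202449409784437539086630422993130942145923496732932689540284158117990854742073076788773717199,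
   116819434668283472230672682453739279756444103050189432124789809281937480615250915889336618871714572615991795173805673581615064403842368719,
   556856358070430671421845025122061505476652219823789803768337625560776021043180791347932854017370348990485378343148359898047786127721702692303,
   751914316472589155196314547287536760015936079880537889781212638837816080218386571427571521979800861764963330232165178058577223000569937903,
   158007912092223863617689510616636912641516185311847810601508900189275399657378120044662372872557948637929879325334563247128313289867733199,
   2616619222823203458860897564150829681465686797600886241320197525851878618274009676569128270569675445582267012083785067350615818503719077279,
   29067001840361562042021456090457977194909022212999984886632198430307377736924437775105950708088685667267375156915670612629020629785957238863,
   935867157225322889698099235131214974473815387334286550976338116310699261832321282846559731725611493336657593542489226517547824959746511727,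
   9494211488942152615641553196564892751494656204630246582501909586654238167305174769673008750894970703290691036182031539878309017403947158239327,
   669854522138844156114801925397788665867282349915839833134652443327033589625150455809119401164502802354039821703690139816868488522771046858491,
   32182475591994880874462413445208482367024482105078243613774699734808369420212532703600654748132888687119761235213252263123681359103986607,
   2114684000072812263506583574514970924640844798258159154491141224448472738911889210624488580897938268612795167501490005860285270047271664404047,
   144657402857645042826368352027838841747725745386726462240469442547315454460177552476466063003187679659093768298513896535098481062072970079,
   9626146992999651350490021043407322194648798408186079377468259538833132282212727288753713583465744936375796700713312044767547079652076352992447,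
   8642751904392591067112718411929101488369352724063208132693411397986509687960815389451806788440352330449498703196346061229480365251946540893375,
   10717672354127800587280881724531045759083637492201431630545415556985861509060167367790543758575855904777461785752881598488671898727581955939070,
   709867448586275670421690766424995348315977895561425231028792872497481299600828784874743202590352042711666845368855198903611941574069208943535,
   9745334295200944016399241167137407959465024181383284611621934888206964373722775931252983570632240120371151751581038172021656715723591967070335,
   5346178049076192614978961196601416860070538702203817744548777320538698825302564193293870572276140644605700424840220114036060963605897632235711,
   4866165591154482441080149561521151290405734564934708882973407385541215143872561383819190343880381061348472784649256139314739082617244905508015,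
   2638072433740919909021824329270436922988840914711373213142815082750400740606490046226400507493651730494646629952169259740955753903857598447,
   71471410415162642034952265858112155549585867995970886508862072372023884615830566605885578559240181645365890566030090012210456027517797951,
   1711381458997542042935006829038608288124096256942145754827804689660182539691349366312038253996526311513636971797450880425163378538821274783,
   360872422507349583813695101469370504109977095870059270020239167168575639057615985774609629951987458699626871906659211254254160610267614221471,
   22554529423859549150660644889513424586769074671447770218185986568471291098035943554859945126803871528931445178891423513135362139916392893759,
   373110963058171621425024358177199362770577189528899203230452410507874559950228543]

end CubicSearch

/-! ### Meaning of the bit operations -/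

namespace CubicSearch

open Classical in
noncomputable def bits (x : ℕ) : Finset ℕ := (Finset.range 14).filter fun i => Nat.testBit x i = true

def Mem (M i j : ℕ) : Prop := Nat.testBit M (pos i j) = true

lemma force_eq {α : Type} (n : ℕ) (k : ℕ → α) : force n k = k n := by cases n <;> rfl

lemma sel_false {α : Type} (t e : α) : sel false t e = e := rfl

lemma beq_iff {a b : ℕ} : Nat.beq a b = true ↔ a = b :=
  ⟨Nat.eq_of_beq_eq_true, fun h => h ▸ Nat.beq_refl a⟩

lemma testBit_lor (a b n : ℕ) :
    Nat.testBit (Nat.lor a b) n = (Nat.testBit a n || Nat.testBit b n) := Nat.testBit_or a b n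

lemma testBit_land (a b n : ℕ) :
    Nat.testBit (Nat.land a b) n = (Nat.testBit a n && Nat.testBit b n) := Nat.testBit_and a b n

lemma testBit_xor' (a b n : ℕ) :
    Nat.testBit (Nat.xor a b) n = (Nat.testBit a n ^^ Nat.testBit b n) := Nat.testBit_xor a b n

lemma testBit_single (i n : ℕ) : Nat.testBit (Nat.shiftLeft 1 i) n = decide (i = n) := by
  change Nat.testBit (1 <<< i) n = _
  rw [Nat.one_shiftLeft, Nat.testBit_two_pow]

lemma pos_eq (i j : ℕ) : pos i j = 16 * i + (j + 64) := rfl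

lemma testBit_full (n : ℕ) : Nat.testBit 16383 n = decide (n < 14) :=
  Nat.testBit_two_pow_sub_one 14 n

lemma testBit_row {M i j : ℕ} (hj : j < 14) : Nat.testBit (row M i) j = Nat.testBit M (pos i j) := by
  rw [row, testBit_land, testBit_full]
  change (Nat.testBit (M >>> (pos i 0)) j && _) = _
  rw [Nat.testBit_shiftRight]
  simp [hj, pos_eq]
  congr 1; ring

lemma row_lt (M i : ℕ) : row M i < 2 ^ 14 :=
  lt_of_le_of_lt (Nat.and_le_right (n := Nat.shiftRight M (pos i 0)) (m := 16383)) (by norm_num)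

lemma mem_bits_row {M i j : ℕ} : j ∈ bits (row M i) ↔ j < 14 ∧ Mem M i j := by
  simp only [bits, Finset.mem_filter, Finset.mem_range, Mem]
  exact and_congr_right fun h => by rw [testBit_row h]

lemma mem_setPair {M i j a b : ℕ} (hj : j < 14) (hi : i < 14) (hb : b < 14) :
    Mem (setPair M i j) a b ↔ Mem M a b ∨ (i = a ∧ j = b) ∨ (j = a ∧ i = b) := by
  simp only [Mem, setPair, testBit_lor, testBit_single, pos_eq, Bool.or_eq_true, decide_eq_true_eq]
  have e1 : 16 * i + (j + 64) = 16 * a + (b + 64) ↔ i = a ∧ j = b := by omega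
  have e2 : 16 * j + (i + 64) = 16 * a + (b + 64) ↔ j = a ∧ i = b := by omega
  rw [e1, e2]

/-- The checksum is below `2 ^ 31`, whereas pairs are stored from bit 64 on. -/
lemma mem_stir {M a b : ℕ} : Mem (stir M) a b ↔ Mem M a b := by
  simp only [Mem, stir, force_eq, testBit_xor']
  have h : Nat.testBit (Nat.mod M 2147483647) (pos a b) = false := by
    apply Nat.testBit_lt_two_pow
    have h1 : M % 2147483647 < 2147483647 := Nat.mod_lt _ (by norm_num)
    have h2 : 2 ^ 64 ≤ 2 ^ pos a b := Nat.pow_le_pow_right (by norm_num) (by rw [pos_eq]; omega)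
    exact lt_of_lt_of_le (lt_trans h1 (by norm_num)) h2
  rw [h, Bool.xor_false]

lemma testBit_cross : ∀ i < 14, ∀ a < 14, ∀ b < 14,
    (Nat.testBit (Nat.shiftLeft fullRow (pos i 0)) (pos a b) = decide (a = i)) ∧
    (Nat.testBit (Nat.shiftLeft fullCol i) (pos a b) = decide (b = i)) := by
  decide +kernel

lemma mem_setCross {M i a b : ℕ} (hi : i < 14) (ha : a < 14) (hb : b < 14) :
    Mem (setCross M i) a b ↔ Mem M a b ∨ a = i ∨ b = i := by
  obtain ⟨h1, h2⟩ := testBit_cross i hi a ha b hb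
  simp only [Mem, setCross, testBit_lor, h1, h2, Bool.or_eq_true, decide_eq_true_eq]

/-- Explains `clearLow`: conjunction with the predecessor deletes exactly one bit, so each
application to a nonzero number lowers the bit count by one. -/
lemma exists_lowest_bit (x : ℕ) (hx : x ≠ 0) : ∃ k, Nat.testBit x k = true ∧
    ∀ j, (Nat.testBit x j && Nat.testBit (x - 1) j) = (Nat.testBit x j && decide (j ≠ k)) := by
  induction x using Nat.strong_induction_on with
  | _ x ih =>
    rcases Nat.even_or_odd' x with ⟨m, rfl | rfl⟩
    -- Above bit 0, the bits of `2 * m - 1` are those of `m - 1`, so the lowest bit of `m` moves up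
    -- by one place.
    · obtain ⟨k, hk, h⟩ := ih m (by omega) (by omega)
      refine ⟨k + 1, by rw [Nat.testBit_succ]; simpa using hk, fun j => ?_⟩
      cases j with
      | zero => simp
      | succ j =>
        have e : (2 * m - 1) / 2 = m - 1 := by omega
        simpa [Nat.testBit_succ, e] using h j
    · refine ⟨0, by simp, fun j => ?_⟩
      cases j with
      | zero => simp
      | succ j =>
        have e : (2 * m + 1) / 2 = m := by omega
        simp [Nat.testBit_succ, e]

lemma bits_zero : bits 0 = ∅ := by simp [bits]

lemma clearLow_lt {x : ℕ} (hx : x < 2 ^ 14) : clearLow x < 2 ^ 14 :=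
  lt_of_le_of_lt (Nat.and_le_left (n := x) (m := Nat.pred x)) hx

lemma card_bits_clearLow {x : ℕ} (hx : x < 2 ^ 14) (h0 : x ≠ 0) :
    (bits x).card = (bits (clearLow x)).card + 1 := by
  obtain ⟨k, hk, h⟩ := exists_lowest_bit x h0
  have hk14 : k < 14 := by
    by_contra hc
    rw [Nat.testBit_lt_two_pow (lt_of_lt_of_le hx (Nat.pow_le_pow_right (by norm_num) (by omega)))] at hk
    cases hk
  have e : bits (clearLow x) = (bits x).erase k := by
    ext j
    have := h j
    simp only [bits, clearLow, testBit_land, Finset.mem_erase, Finset.mem_filter, Finset.mem_range]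
    rw [Nat.pred_eq_sub_one, this]
    simp; tauto
  have hm : k ∈ bits x := by simp [bits, hk, hk14]
  rw [e, Finset.card_erase_of_mem hm]
  have := Finset.card_pos.2 ⟨k, hm⟩
  omega

lemma atMostThree_iff {x : ℕ} (hx : x < 2 ^ 14) : atMostThree x = true ↔ (bits x).card ≤ 3 := by
  have c0 : clearLow 0 = 0 := rfl
  have h1 := clearLow_lt hx
  have h2 := clearLow_lt h1
  have h3 := clearLow_lt h2
  have key : ∀ y < 2 ^ 14, (y = 0 ∧ (bits y).card = 0 ∧ clearLow y = 0) ∨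
      (y ≠ 0 ∧ (bits y).card = (bits (clearLow y)).card + 1) := by
    intro y hy
    by_cases h : y = 0
    · left; subst h; simp [bits_zero, c0]
    · right; exact ⟨h, card_bits_clearLow hy h⟩
  have k0 := key _ hx
  have k1 := key _ h1
  have k2 := key _ h2
  have k3 := key _ h3
  rw [atMostThree, beq_iff]
  constructor
  · intro h; omega
  · intro h; by_contra hc
    have n2 : clearLow (clearLow x) ≠ 0 := fun h => by rw [h, c0] at hc; exact hc rfl
    have n1 : clearLow x ≠ 0 := fun h => by rw [h, c0] at n2; exact n2 rfl
    have n0 : x ≠ 0 := fun h => by rw [h, c0] at n1; exact n1 rfl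
    omega

/-- Twins have the same relations to all the other vertices. -/
lemma twin_iff {A N i j : ℕ} (h : twin A N i j = true) {b : ℕ} (hb : b < 14) (hi : b ≠ i)
    (hj : b ≠ j) : (Mem A i b ↔ Mem A j b) ∧ (Mem N i b ↔ Mem N j b) := by
  rw [twin, force_eq] at h
  have h := congrArg (fun x => Nat.testBit x b) (Nat.eq_of_beq_eq_true h)
  simp only [testBit_lor, testBit_single, testBit_xor', testBit_row hb] at h
  simp only [Mem]
  have e1 : decide (i = b) = false := by simpa using hi.symm
  have e2 : decide (j = b) = false := by simpa using hj.symm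
  rw [e1, e2] at h
  revert h
  cases Nat.testBit A (pos i b) <;> cases Nat.testBit A (pos j b) <;>
    cases Nat.testBit N (pos i b) <;> cases Nat.testBit N (pos j b) <;> simp

/-- Ensures that excluding the twins of `j` also decides the pair with `j` itself. -/
lemma twin_self (A N j : ℕ) : twin A N j j = true := by
  rw [twin, force_eq]
  rw [beq_iff]
  apply Nat.eq_of_testBit_eq
  intro b
  change Nat.testBit (Nat.lor _ (Nat.lor (row A j ^^^ row A j) (row N j ^^^ row N j))) b = _
  rw [Nat.xor_self, Nat.xor_self]
  simp

end CubicSearch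

/-! ### Labellings that agree with a search state -/

namespace CubicSearch

variable {V : Type*}

/-- Adjacent or equal. -/
def CAdj (G : SimpleGraph V) (x y : V) : Prop := x = y ∨ G.Adj x y

lemma CAdj.symm {G : SimpleGraph V} {x y : V} (h : CAdj G x y) : CAdj G y x :=
  h.imp Eq.symm fun h => h.symm

/-- The labelling `f` of the vertices of `G` agrees with the state `(A, N)` of the search. -/
structure Inv (G : SimpleGraph V) (A N : ℕ) (f : ℕ → V) : Prop where
  inj : ∀ i < 14, ∀ j < 14, f i = f j → i = j
  surj : ∀ v, ∃ i < 14, f i = v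
  -- Labels read as hexadecimal digits may be 14 or 15; their rows in `A` have to be empty.
  lt : ∀ i, ∀ j < 14, Mem A i j → i < 14
  reflA : ∀ i < 14, Mem A i i
  reflN : ∀ i < 14, Mem N i i
  symmA : ∀ i < 14, ∀ j < 14, Mem A i j → Mem A j i
  symmN : ∀ i < 14, ∀ j < 14, Mem N i j → Mem N j i
  adj : ∀ i < 14, ∀ j < 14, Mem A i j → CAdj G (f i) (f j)
  dec : ∀ i < 14, ∀ j < 14, Mem N i j → CAdj G (f i) (f j) → Mem A i j

/-- Agreement of the rows off `{i, j}` handles the pairs with exactly one entry there. Pairs inside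
`{i, j}` go to pairs inside `{i, j}`, which reflexivity and symmetry take care of. -/
lemma mem_swap {M i j : ℕ} (hi : i < 14) (hj : j < 14) (hr : ∀ i < 14, Mem M i i)
    (hs : ∀ i < 14, ∀ j < 14, Mem M i j → Mem M j i)
    (ht : ∀ b < 14, b ≠ i → b ≠ j → (Mem M i b ↔ Mem M j b)) :
    ∀ a < 14, ∀ b < 14, Mem M a b → Mem M (Equiv.swap i j a) (Equiv.swap i j b) := by
  intro a ha b hb k
  have k' := hs a ha b hb k
  by_cases a1 : a = i
  · subst a1
    by_cases b1 : b = a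
    · subst b1; simpa using hr j hj
    by_cases b2 : b = j
    · subst b2; simpa using k'
    rw [Equiv.swap_apply_left, Equiv.swap_apply_of_ne_of_ne b1 b2]
    exact (ht b hb b1 b2).1 k
  by_cases a2 : a = j
  · subst a2
    by_cases b1 : b = i
    · subst b1; simpa using k'
    by_cases b2 : b = a
    · subst b2; simpa using hr i hi
    rw [Equiv.swap_apply_right, Equiv.swap_apply_of_ne_of_ne b1 b2]
    exact (ht b hb b1 b2).2 k
  rw [Equiv.swap_apply_of_ne_of_ne a1 a2]
  by_cases b1 : b = i
  · subst b1
    rw [Equiv.swap_apply_left]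
    exact hs _ hj _ ha ((ht a ha a1 a2).1 k')
  by_cases b2 : b = j
  · subst b2
    rw [Equiv.swap_apply_right]
    exact hs _ hi _ ha ((ht a ha a1 a2).2 k')
  rwa [Equiv.swap_apply_of_ne_of_ne b1 b2]

namespace Inv

variable {G : SimpleGraph V} {A N : ℕ} {f : ℕ → V}

lemma congr {A' N' : ℕ} (h : Inv G A N f) (hA : ∀ i, ∀ j < 14, Mem A' i j ↔ Mem A i j)
    (hN : ∀ i < 14, ∀ j < 14, Mem N' i j ↔ Mem N i j) : Inv G A' N' f where
  inj := h.inj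
  surj := h.surj
  lt i j hj k := h.lt i j hj ((hA i j hj).1 k)
  reflA i hi := (hA i i hi).2 (h.reflA i hi)
  reflN i hi := (hN i hi i hi).2 (h.reflN i hi)
  symmA i hi j hj k := (hA j i hi).2 (h.symmA i hi j hj ((hA i j hj).1 k))
  symmN i hi j hj k := (hN j hj i hi).2 (h.symmN i hi j hj ((hN i hi j hj).1 k))
  adj i hi j hj k := h.adj i hi j hj ((hA i j hj).1 k)
  dec i hi j hj k c := (hA i j hj).2 (h.dec i hi j hj ((hN i hi j hj).1 k) c)

lemma stir_left (h : Inv G A N f) : Inv G (stir A) N f :=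
  h.congr (fun _ _ _ => mem_stir) (fun _ _ _ _ => Iff.rfl)

lemma stir_right (h : Inv G A N f) : Inv G A (stir N) f :=
  h.congr (fun _ _ _ => Iff.rfl) (fun _ _ _ _ => mem_stir)

/-- Decide a pair without adding it to `A`. -/
lemma decide_pair (h : Inv G A N f) {u j : ℕ} (hu : u < 14) (hj : j < 14)
    (huj : CAdj G (f u) (f j) → Mem A u j) : Inv G A (setPair N u j) f :=
  { h with
    reflN := fun i hi => (mem_setPair hj hu hi).2 (Or.inl (h.reflN i hi))
    symmN := fun a ha b hb k => by
      rw [mem_setPair hj hu ha]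
      rw [mem_setPair hj hu hb] at k
      exact k.imp (h.symmN a ha b hb) (by tauto)
    dec := fun a ha b hb k c => by
      rw [mem_setPair hj hu hb] at k
      rcases k with k | ⟨rfl, rfl⟩ | ⟨rfl, rfl⟩
      · exact h.dec a ha b hb k c
      · exact huj c
      · exact h.symmA _ hu _ hj (huj c.symm) }

lemma add_pair (h : Inv G A N f) {u j : ℕ} (hu : u < 14) (hj : j < 14)
    (huj : CAdj G (f u) (f j)) : Inv G (setPair A u j) (setPair N u j) f where
  inj := h.inj
  surj := h.surj
  lt a b hb k := by
    rw [mem_setPair hj hu hb] at k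
    rcases k with k | ⟨rfl, rfl⟩ | ⟨rfl, rfl⟩
    · exact h.lt a b hb k
    · exact hu
    · exact hj
  reflA i hi := (mem_setPair hj hu hi).2 (Or.inl (h.reflA i hi))
  reflN i hi := (mem_setPair hj hu hi).2 (Or.inl (h.reflN i hi))
  symmA a ha b hb k := by
    rw [mem_setPair hj hu ha]
    rw [mem_setPair hj hu hb] at k
    exact k.imp (h.symmA a ha b hb) (by tauto)
  symmN a ha b hb k := by
    rw [mem_setPair hj hu ha]
    rw [mem_setPair hj hu hb] at k
    exact k.imp (h.symmN a ha b hb) (by tauto)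
  adj a ha b hb k := by
    rw [mem_setPair hj hu hb] at k
    rcases k with k | ⟨rfl, rfl⟩ | ⟨rfl, rfl⟩
    · exact h.adj a ha b hb k
    · exact huj
    · exact huj.symm
  dec a ha b hb k c := by
    rw [mem_setPair hj hu hb] at k ⊢
    exact k.imp (fun k => h.dec a ha b hb k c) id

/-- Exchanging two twins gives another labelling that agrees with the state. -/
lemma swap (h : Inv G A N f) {i j : ℕ} (hi : i < 14) (hj : j < 14) (ht : twin A N i j = true) :
    Inv G A N (f ∘ Equiv.swap i j) := by
  have lt : ∀ a < 14, Equiv.swap i j a < 14 := by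
    intro a ha
    by_cases h1 : a = i
    · subst h1; simpa using hj
    by_cases h2 : a = j
    · subst h2; simpa using hi
    rwa [Equiv.swap_apply_of_ne_of_ne h1 h2]
  have hA := mem_swap hi hj h.reflA h.symmA fun b hb h1 h2 => (twin_iff ht hb h1 h2).1
  have hN := mem_swap hi hj h.reflN h.symmN fun b hb h1 h2 => (twin_iff ht hb h1 h2).2
  refine { h with inj := ?_, surj := ?_, adj := ?_, dec := ?_ }
  · intro a ha b hb k
    exact (Equiv.swap i j).injective (h.inj _ (lt a ha) _ (lt b hb) k)
  · intro v
    obtain ⟨a, ha, rfl⟩ := h.surj v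
    exact ⟨Equiv.swap i j a, lt a ha, by simp⟩
  · intro a ha b hb k
    exact h.adj _ (lt a ha) _ (lt b hb) (hA a ha b hb k)
  · intro a ha b hb k c
    have := hA _ (lt a ha) _ (lt b hb) (h.dec _ (lt a ha) _ (lt b hb) (hN a ha b hb k) c)
    simpa using this

open Classical in
/-- The labels of the closed neighbourhood of `f u`. -/
noncomputable def nbr (G : SimpleGraph V) (f : ℕ → V) (u : ℕ) : Finset ℕ :=
  (Finset.range 14).filter fun i => CAdj G (f u) (f i)

/-- `f` maps these labels bijectively onto a closed neighbourhood, which in a cubic graph has 1 + 3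
vertices. This is why the thresholds on rows of `A`, which contain the diagonal, are three and four.
-/
lemma card_nbr (h : Inv G A N f) (hG : ∀ v, (G.neighborSet v).ncard = 3) (u : ℕ) :
    (nbr G f u).card = 4 := by
  have e : f '' (nbr G f u : Set ℕ) = insert (f u) (G.neighborSet (f u)) := by
    ext v
    constructor
    · rintro ⟨i, hi, rfl⟩
      simp only [nbr, Finset.coe_filter, Set.mem_ofPred_eq] at hi
      exact hi.2.imp Eq.symm id
    · intro hv
      obtain ⟨i, hi, rfl⟩ := h.surj v
      refine ⟨i, ?_, rfl⟩
      simp only [nbr, Finset.coe_filter, Set.mem_ofPred_eq, Finset.mem_range]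
      exact ⟨hi, hv.imp Eq.symm id⟩
  have hinj : Set.InjOn f (nbr G f u : Set ℕ) := by
    intro a ha b hb k
    simp only [nbr, Finset.coe_filter, Set.mem_ofPred_eq, Finset.mem_range] at ha hb
    exact h.inj a ha.1 b hb.1 k
  have h1 := hinj.ncard_image
  rw [e, Set.ncard_insert_of_notMem (by simp)
    (Set.finite_of_ncard_ne_zero (by rw [hG]; norm_num)), hG, Set.ncard_coe_finset] at h1
  exact h1.symm

lemma bits_subset_nbr (h : Inv G A N f) {u : ℕ} (hu : u < 14) : bits (row A u) ⊆ nbr G f u := by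
  intro j hj
  rw [mem_bits_row] at hj
  simp only [nbr, Finset.mem_filter, Finset.mem_range]
  exact ⟨hj.1, h.adj u hu j hj.1 hj.2⟩

lemma saturate (h : Inv G A N f) (hG : ∀ v, (G.neighborSet v).ncard = 3) {i : ℕ} (hi : i < 14) :
    Inv G A (saturate A N i) f := by
  rw [CubicSearch.saturate]
  cases hc : atMostThree (row A i) with
  | true => exact h
  | false =>
    rw [sel_false]
    have h4 : ¬ (bits (row A i)).card ≤ 3 := by
      rw [← atMostThree_iff (row_lt A i), hc]; simp
    -- At least four known labels inside a closed neighbourhood of size four: nothing is missing, so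
    -- every other pair with `i` is a non-edge.
    have e := Finset.eq_of_subset_of_card_le (h.bits_subset_nbr hi)
      (by rw [h.card_nbr hG]; omega)
    have key : ∀ b < 14, CAdj G (f i) (f b) → Mem A i b := by
      intro b hb k
      have : b ∈ nbr G f i := by simp [nbr, hb, k]
      rw [← e, mem_bits_row] at this
      exact this.2
    exact { h with
      reflN := fun a ha => (mem_setCross hi ha ha).2 (Or.inl (h.reflN a ha))
      symmN := fun a ha b hb k => by
        rw [mem_setCross hi hb ha]
        rw [mem_setCross hi ha hb] at k
        exact k.imp (h.symmN a ha b hb) Or.symm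
      dec := fun a ha b hb k c => by
        rw [mem_setCross hi ha hb] at k
        rcases k with k | rfl | rfl
        · exact h.dec a ha b hb k c
        · exact key b hb c
        · exact h.symmA _ hb _ ha (key a ha c.symm) }

/-- Twins are tested against the fixed `N` while the exclusions accumulate in `R`, so `hx` applies
unchanged at every step. The last two conclusions say that no decided pair is lost and that `(u, j)`
becomes decided; the loop in `tryEdges` needs both in order to move on to `j + 1`. -/
lemma exclude_twins {u j : ℕ} (hu : u < 14)
    (hx : ∀ i < 14, ¬ Mem N u i → twin A N i j = true → ¬ CAdj G (f u) (f i)) (k : ℕ) :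
    ∀ i R, i + k = 14 → Inv G A R f → Inv G A (excludeTwins A N u j k i R) f ∧
      (∀ a < 14, ∀ b < 14, Mem R a b → Mem (excludeTwins A N u j k i R) a b) ∧
      (i ≤ j → j < 14 → ¬ Mem N u j → Mem (excludeTwins A N u j k i R) u j) := by
  induction k with
  | zero =>
    intro i R hik hR
    exact ⟨hR, fun _ _ _ _ => id, by omega⟩
  | succ k ih =>
    intro i R hik hR
    have hi : i < 14 := by omega
    have step : excludeTwins A N u j (k + 1) i R =
      sel (Nat.testBit N (pos u i)) (excludeTwins A N u j k (i + 1) R)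
        (sel (twin A N i j) (force (setPair R u i) fun R' => excludeTwins A N u j k (i + 1) R')
          (excludeTwins A N u j k (i + 1) R)) := rfl
    rw [step, force_eq]
    have ih1 := ih (i + 1) R (by omega) hR
    cases hN : Nat.testBit N (pos u i) with
    | true =>
      refine ⟨ih1.1, ih1.2.1, fun hij hj hNj => ih1.2.2 ?_ hj hNj⟩
      rcases Nat.lt_or_ge i j with h' | h'
      · exact h'
      · exact absurd (show Mem N u j by rw [show j = i by omega]; exact hN) hNj
    | false =>
      have hNi : ¬ Mem N u i := by simp [Mem, hN]
      cases ht : twin A N i j with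
      | true =>
        have ih2 := ih (i + 1) (setPair R u i) (by omega)
          (hR.decide_pair hu hi fun c => absurd c (hx i hi hNi ht))
        refine ⟨ih2.1, fun a ha b hb k => ih2.2.1 a ha b hb
          ((mem_setPair hi hu hb).2 (Or.inl k)), fun hij hj hNj => ?_⟩
        rcases Nat.lt_or_ge i j with h' | h'
        · exact ih2.2.2 h' hj hNj
        · obtain rfl : j = i := by omega
          exact ih2.2.1 u hu j hj ((mem_setPair hi hu hi).2 (by tauto))
      | false =>
        refine ⟨ih1.1, ih1.2.1, fun hij hj hNj => ih1.2.2 ?_ hj hNj⟩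
        rcases Nat.lt_or_ge i j with h' | h'
        · exact h'
        · obtain rfl : j = i := by omega
          rw [twin_self] at ht; cases ht

end Inv

/-- A common element of the two rows is a walk of length at most two from `u` to `j`, to be closed
up to a triangle by the edge under trial. -/
lemma mem_nearby_one {A u j : ℕ} (h : Nat.land (nearby 1 A u) (row A j) ≠ 0) :
    ∃ x < 14, Mem A u x ∧ Mem A j x := by
  obtain ⟨x, hx⟩ := Nat.exists_testBit_of_ne_zero h
  rw [testBit_land, Bool.and_eq_true] at hx
  have hx14 : x < 14 := by
    by_contra hc
    rw [Nat.testBit_lt_two_pow (lt_of_lt_of_le (row_lt A j)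
      (Nat.pow_le_pow_right (by norm_num) (not_lt.1 hc)))] at hx
    cases hx.2
  refine ⟨x, hx14, ?_, ?_⟩
  · have : Nat.testBit (row A u) x = true := hx.1
    rwa [testBit_row hx14] at this
  · have := hx.2
    rwa [testBit_row hx14] at this

lemma testBit_unionRows {A x b : ℕ} (hb : b < 14) (k : ℕ) : ∀ i R,
    Nat.testBit (unionRows A x k i R) b = true →
      Nat.testBit R b = true ∨ ∃ y < i + k, Nat.testBit x y = true ∧ Mem A y b := by
  induction k with
  | zero => exact fun i R h => Or.inl h
  | succ k ih =>
    intro i R h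
    have step : unionRows A x (k + 1) i R = sel (Nat.testBit x i)
      (unionRows A x k (i + 1) (Nat.lor R (row A i))) (unionRows A x k (i + 1) R) := rfl
    rw [step] at h
    cases hx : Nat.testBit x i with
    | true =>
      rw [hx] at h
      rcases ih _ _ h with h | ⟨y, hy, h⟩
      · rw [testBit_lor, Bool.or_eq_true, testBit_row hb] at h
        exact h.imp id fun h => ⟨i, by omega, hx, h⟩
      · exact Or.inr ⟨y, by omega, h⟩
    | false =>
      rw [hx] at h
      exact (ih _ _ h).imp id fun ⟨y, hy, h⟩ => ⟨y, by omega, h⟩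

/-- Here the ball of radius two about `u` meets the closed ball of radius one about `j`: a walk `u,
y, x, j`, in which consecutive entries may coincide. -/
lemma mem_nearby_two {A u j g : ℕ} (h : Nat.land (nearby (g + 2) A u) (row A j) ≠ 0) :
    ∃ y < 14, ∃ x < 14, Mem A u y ∧ Mem A y x ∧ Mem A j x := by
  obtain ⟨x, hx⟩ := Nat.exists_testBit_of_ne_zero h
  rw [testBit_land, Bool.and_eq_true] at hx
  have hx14 : x < 14 := by
    by_contra hc
    rw [Nat.testBit_lt_two_pow (lt_of_lt_of_le (row_lt A j)
      (Nat.pow_le_pow_right (by norm_num) (not_lt.1 hc)))] at hx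
    cases hx.2
  have h1 : Nat.testBit (unionRows A (row A u) 14 0 0) x = true := hx.1
  rcases testBit_unionRows hx14 14 0 0 h1 with h1 | ⟨y, hy, h1, h2⟩
  · simp at h1
  · have hy : y < 14 := by omega
    refine ⟨y, hy, x, hx14, ?_, h2, ?_⟩
    · rwa [testBit_row hy] at h1
    · have := hx.2
      rwa [testBit_row hx14] at this

end CubicSearch

/-! ### Soundness of the search -/

namespace CubicSearch

variable {V : Type*} {G : SimpleGraph V} {A N : ℕ} {f : ℕ → V}

lemma sel_eq_some {α : Type} {b : Bool} {t e : Option α} {x : α} (h : sel b t e = some x) :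
    (b = true ∧ t = some x) ∨ (b = false ∧ e = some x) := by
  cases b
  · exact Or.inr ⟨rfl, h⟩
  · exact Or.inl ⟨rfl, h⟩

lemma sel_eq_true {b t : Bool} (h : sel b t false = true) : b = true ∧ t = true := by
  cases b
  · cases h
  · exact ⟨rfl, h⟩

namespace Inv

lemma mem_of_common (h : Inv G A N f)
    (hT : ∀ a b c, G.Adj a b → G.Adj b c → ¬ G.Adj a c) {u j x : ℕ} (hu : u < 14) (hj : j < 14)
    (hx : x < 14) (hux : Mem A u x) (hjx : Mem A j x) (huj : CAdj G (f u) (f j)) : Mem A u j := by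
  rcases huj with e | e
  · rw [h.inj u hu j hj e]; exact h.reflA j hj
  rcases h.adj u hu x hx hux with e1 | e1
  · rw [← h.inj u hu x hx e1] at hjx; exact h.symmA j hj u hu hjx
  rcases h.adj j hj x hx hjx with e2 | e2
  · rwa [h.inj j hj x hx e2]
  · exact absurd e1 (hT _ _ _ e e2)

/-- Justifies pruning: an adjacency between `u` and `j` that is not already in `A` would complete a
forbidden cycle, so the pair may be decided negatively. -/
lemma mem_of_nearby (h : Inv G A N f) {girth : ℕ}
    (hT : 1 ≤ girth → ∀ a b c, G.Adj a b → G.Adj b c → ¬ G.Adj a c)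
    (hS : 2 ≤ girth → ∀ a b c d, G.Adj a b → G.Adj b c → G.Adj c d → a ≠ c → b ≠ d → ¬ G.Adj d a)
    {u j : ℕ} (hu : u < 14) (hj : j < 14)
    (hn : Nat.land (nearby girth A u) (row A j) ≠ 0) (huj : CAdj G (f u) (f j)) : Mem A u j := by
  match girth, hT, hS, hn with
  | 0, _, _, hn =>
    have e : Nat.land (nearby 0 A u) (row A j) = 0 := Nat.zero_and (row A j)
    exact absurd e hn
  | 1, hT, _, hn =>
    obtain ⟨x, hx, h1, h2⟩ := mem_nearby_one hn
    exact h.mem_of_common (hT le_rfl) hu hj hx h1 h2 huj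
  | g + 2, hT, hS, hn =>
    obtain ⟨y, hy, x, hx, h1, h2, h3⟩ := mem_nearby_two hn
    have hT := hT (by omega)
    have hS := hS (by omega)
    -- Any coincidence among `u, y, x, j` either shortens the walk to the triangle case or shows
    -- that the pair is in `A`. Once these are excluded, the four vertices form a genuine 4-cycle.
    by_cases hxy : y = x
    · subst hxy; exact h.mem_of_common hT hu hj hy h1 h3 huj
    by_cases huy : u = y
    · subst huy; exact h.mem_of_common hT hu hj hx h2 h3 huj
    by_cases hjx : j = x
    · subst hjx; exact h.mem_of_common hT hu hj hy h1 (h.symmA _ hy _ hj h2) huj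
    by_cases hux : u = x
    · subst hux; exact h.symmA _ hj _ hu h3
    by_cases hjy : j = y
    · subst hjy; exact h1
    rcases huj with e | e
    · rw [h.inj u hu j hj e]; exact h.reflA j hj
    have e1 := (h.adj u hu y hy h1).resolve_left fun k => huy (h.inj _ hu _ hy k)
    have e2 := (h.adj y hy x hx h2).resolve_left fun k => hxy (h.inj _ hy _ hx k)
    have e3 := (h.adj j hj x hx h3).resolve_left fun k => hjx (h.inj _ hj _ hx k)
    exact absurd e.symm (hS _ _ _ _ e1 e2 e3.symm (fun k => hux (h.inj _ hu _ hx k))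
      (fun k => hjy (h.inj _ hy _ hj k).symm))

end Inv

/-- `Q` does not depend on the labelling, and `hrec` is assumed for all labellings; this is what
permits relabelling by a swap of twins. `hU` ranges over all `N` because the loop enlarges `N` while
`A` and `U` stay fixed. -/
lemma tryEdges_sound (hG : ∀ v, (G.neighborSet v).ncard = 3) {Q : Prop}
    {rec : ℕ → ℕ → List ℕ → Option (List ℕ)}
    (hrec : ∀ A N c c', rec A N c = some c' → ∀ f, Inv G A N f → Q) {u U : ℕ} (hu : u < 14)
    (h3 : atMostThree (row A u) = true)
    (hU : ∀ N f, Inv G A N f → ∀ j < 14, Nat.land U (row A j) ≠ 0 →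
      CAdj G (f u) (f j) → Mem A u j) (k : ℕ) :
    ∀ j N c c' f, j + k = 14 → (∀ i < j, Mem N u i) → Inv G A N f →
      tryEdges rec A u U k j N c = some c' → Q := by
  induction k with
  | zero =>
    intro j N c c' f hjk hd h _
    -- End of the loop: all pairs at `u` are decided, so the closed neighbourhood of `u` is its row
    -- in `A`. That row has at most three elements, but four are needed.
    have hsub : Inv.nbr G f u ⊆ bits (row A u) := by
      intro i hi
      simp only [Inv.nbr, Finset.mem_filter, Finset.mem_range] at hi
      rw [mem_bits_row]
      exact ⟨hi.1, h.dec u hu i hi.1 (hd i (by omega)) hi.2⟩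
    have h1 := Finset.card_le_card hsub
    rw [h.card_nbr hG] at h1
    have h2 := (atMostThree_iff (row_lt A u)).1 h3
    omega
  | succ k ih =>
    intro j N c c' f hjk hd h hs
    have hj : j < 14 := by omega
    have step : tryEdges rec A u U (k + 1) j N c =
      sel (Nat.testBit N (pos u j)) (tryEdges rec A u U k (j + 1) N c)
        (sel (Nat.beq (Nat.land U (row A j)) 0)
          (Option.rec none
            (fun c' => force (stir (excludeTwins A N u j (k + 1) j N)) fun N' =>
              tryEdges rec A u U k (j + 1) N' c')
            (force (stir (setPair A u j)) fun A' =>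
              force (stir (saturate A' (saturate A' (setPair N u j) u) j)) fun N' => rec A' N' c))
          (force (stir (setPair N u j)) fun N' => tryEdges rec A u U k (j + 1) N' c)) := rfl
    rw [step] at hs
    simp only [force_eq] at hs
    rcases sel_eq_some hs with ⟨hN, hs⟩ | ⟨hN, hs⟩
    · refine ih (j + 1) N c c' f (by omega) (fun i hi => ?_) h hs
      rcases Nat.lt_succ_iff_lt_or_eq.1 hi with hi | rfl
      · exact hd i hi
      · exact hN
    have hNj : ¬ Mem N u j := by simp [Mem, hN]
    rcases sel_eq_some hs with ⟨_, hs⟩ | ⟨hb, hs⟩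
    · cases hr : rec (stir (setPair A u j)) (stir (saturate (stir (setPair A u j))
          (saturate (stir (setPair A u j)) (setPair N u j) u) j)) c with
      | none => rw [hr] at hs; cases hs
      | some c1 =>
        rw [hr] at hs
        -- The successful recursive call settles every labelling in which `u` is joined to `j`.
        have child : ∀ f', Inv G A N f' → CAdj G (f' u) (f' j) → Q := fun f' h' a =>
          hrec _ _ _ _ hr f'
            ((((h'.add_pair hu hj a).stir_left.saturate hG hu).saturate hG hj).stir_right)
        -- If `u` is joined to some undecided twin `i` of `j`, exchanging the two labels leads to
        -- the branch just settled. Otherwise all these twins are non-neighbours and the loop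
        -- continues with them excluded.
        by_cases hx : ∃ i < 14, ¬ Mem N u i ∧ twin A N i j = true ∧ CAdj G (f u) (f i)
        · obtain ⟨i, hi, hNi, ht, hc⟩ := hx
          refine child _ (h.swap hi hj ht) ?_
          have h1 : u ≠ i := fun e => hNi (e ▸ h.reflN u hu)
          have h2 : u ≠ j := fun e => hNj (e ▸ h.reflN u hu)
          simpa [Equiv.swap_apply_of_ne_of_ne h1 h2] using hc
        · obtain ⟨h1, h2, h3'⟩ := Inv.exclude_twins (N := N) (j := j) hu
            (fun i hi a b c => hx ⟨i, hi, a, b, c⟩) (k + 1) j N hjk h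
          refine ih (j + 1) _ c1 c' f (by omega) (fun i hi => ?_) h1.stir_right hs
          rw [mem_stir]
          rcases Nat.lt_succ_iff_lt_or_eq.1 hi with hi | rfl
          · exact h2 u hu i (by omega) (hd i hi)
          · exact h3' le_rfl hj hNj
    · have hne : Nat.land U (row A j) ≠ 0 := fun e => by rw [e] at hb; cases hb
      refine ih (j + 1) _ c c' f (by omega) (fun i hi => ?_)
        (h.decide_pair hu hj (hU N f h j hj hne)).stir_right hs
      rw [mem_stir, mem_setPair hj hu (by omega)]
      rcases Nat.lt_succ_iff_lt_or_eq.1 hi with hi | rfl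
      · exact Or.inl (hd i hi)
      · tauto

lemma isComponent_sound {m : ℕ} (k : ℕ) : ∀ i, isComponent A N m k i = true →
    ∀ a, i ≤ a → a < i + k → Nat.testBit m a = true →
      Nat.lor m (row A a) = m ∧ row N a = 16383 := by
  induction k with
  | zero => intro i _ a h1 h2; omega
  | succ k ih =>
    intro i h a h1 h2 ha
    have step : isComponent A N m (k + 1) i = sel (Nat.testBit m i)
        (sel (Nat.beq (Nat.lor m (row A i)) m)
          (sel (Nat.beq (row N i) 16383) (isComponent A N m k (i + 1)) false) false)
        (isComponent A N m k (i + 1)) := rfl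
    rw [step] at h
    cases hm : Nat.testBit m i with
    | false =>
      rw [hm] at h
      have : i ≠ a := fun e => by rw [e, ha] at hm; cases hm
      exact ih _ h a (by omega) (by omega) ha
    | true =>
      rw [hm] at h
      obtain ⟨e1, h⟩ := sel_eq_true h
      obtain ⟨e2, h⟩ := sel_eq_true h
      by_cases e : i = a
      · subst e; exact ⟨beq_iff.1 e1, beq_iff.1 e2⟩
      · exact ih _ h a (by omega) (by omega) ha

/-- The rows in `m` are fully decided and stay inside `m`, so `m` is closed under adjacency in `G`
itself and not only in `A`. By connectedness it would contain all labels, which `h1` forbids. -/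
lemma Inv.not_isComponent (h : Inv G A N f) (hC : G.Connected) {m : ℕ} (h0 : m ≠ 0)
    (h1 : m < 16383) : isComponent A N m 14 0 = false := by
  rw [Bool.eq_false_iff]
  intro hm
  have lt : ∀ i, Nat.testBit m i = true → i < 14 := by
    intro i hi
    by_contra hc
    rw [Nat.testBit_lt_two_pow (lt_of_lt_of_le (lt_trans h1 (by norm_num : _ < 2 ^ 14))
      (Nat.pow_le_pow_right (by norm_num) (not_lt.1 hc)))] at hi
    cases hi
  obtain ⟨i, hi⟩ := Nat.exists_testBit_of_ne_zero h0
  have closed : ∀ a b, G.Adj a b → (∃ i, Nat.testBit m i = true ∧ f i = a) →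
      ∃ i, Nat.testBit m i = true ∧ f i = b := by
    rintro _ b hab ⟨i, hi, rfl⟩
    obtain ⟨j, hj, rfl⟩ := h.surj b
    obtain ⟨e1, e2⟩ := isComponent_sound 14 0 hm i (Nat.zero_le _) (by have := lt i hi; omega) hi
    have hN : Mem N i j := by
      rw [Mem, ← testBit_row hj, e2, testBit_full]; simpa using hj
    have hA := h.dec i (lt i hi) j hj hN (Or.inr hab)
    refine ⟨j, ?_, rfl⟩
    rw [← e1, testBit_lor, testBit_row hj]
    simp only [Mem] at hA
    simp [hA]
  have all : ∀ v, ∃ i, Nat.testBit m i = true ∧ f i = v := by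
    intro v
    obtain ⟨w⟩ := hC.preconnected (f i) v
    have : ∀ a b (_ : G.Walk a b), (∃ i, Nat.testBit m i = true ∧ f i = a) →
        ∃ i, Nat.testBit m i = true ∧ f i = b := by
      intro a b w
      induction w with
      | nil => exact id
      | cons hab _ ih => exact fun ha => ih (closed _ _ hab ha)
    exact this _ _ w ⟨i, hi, rfl⟩
  have : m = 16383 := by
    apply Nat.eq_of_testBit_eq
    intro b
    rw [testBit_full, Bool.eq_iff_iff, decide_eq_true_eq]
    refine ⟨lt b, fun hb => ?_⟩
    obtain ⟨i, hi, e⟩ := all (f b)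
    rwa [← h.inj i (lt i hi) b hb e]
  omega

lemma Inv.not_isDominated (h : Inv G A N f)
    (hD : ∀ S : Finset V, G.IsDominatingSet S → 5 ≤ S.card) (n : ℕ) : isDominated A n = false := by
  classical
  rw [Bool.eq_false_iff]
  intro hd
  have hd := beq_iff.1 hd
  have : G.IsDominatingSet {f (digit n 1), f (digit n 2), f (digit n 3), f (digit n 4)} := by
    intro v hv
    obtain ⟨b, hb, rfl⟩ := h.surj v
    have hb' : Nat.testBit 16383 b = true := by rw [testBit_full]; simpa using hb
    rw [← hd] at hb'
    simp only [testBit_lor, testBit_row hb, Bool.or_eq_true] at hb'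
    have key : ∀ i, Nat.testBit A (pos i b) = true → CAdj G (f b) (f i) := fun i hi =>
      (h.adj i (h.lt i b hb hi) b hb hi).symm
    simp only [Finset.mem_insert, Finset.mem_singleton, not_or] at hv
    rcases hb' with (hi | hi) | (hi | hi)
    · exact ⟨_, by simp, (key _ hi).resolve_left hv.1⟩
    · exact ⟨_, by simp, (key _ hi).resolve_left hv.2.1⟩
    · exact ⟨_, by simp, (key _ hi).resolve_left hv.2.2.1⟩
    · exact ⟨_, by simp, (key _ hi).resolve_left hv.2.2.2⟩
  have h5 := hD _ this
  have h4 := Finset.card_le_four (a := f (digit n 1)) (b := f (digit n 2)) (c := f (digit n 3))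
    (d := f (digit n 4))
  omega

/-- Both directions serve in `Inv.exists_iso`: one bounds the digits, the other makes the
relabelling surjective, hence bijective by counting. -/
lemma coversAll_sound {p : ℕ} (k : ℕ) : ∀ i R, coversAll p k i R = true → ∀ b,
    b < 14 ↔ Nat.testBit R b = true ∨ ∃ x, i ≤ x ∧ x < i + k ∧ digit p x = b := by
  induction k with
  | zero =>
    intro i R h b
    rw [beq_iff.1 (show Nat.beq R 16383 = true from h), testBit_full, decide_eq_true_eq]
    exact ⟨Or.inl, fun h => h.elim id fun ⟨x, h1, h2, _⟩ => by omega⟩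
  | succ k ih =>
    intro i R h b
    rw [ih (i + 1) (Nat.lor R (Nat.shiftLeft 1 (digit p i))) h b, testBit_lor, testBit_single,
      Bool.or_eq_true, decide_eq_true_eq, or_assoc]
    refine or_congr_right ⟨?_, ?_⟩
    · rintro (e | ⟨x, h1, h2, e⟩)
      · exact ⟨i, le_rfl, by omega, e⟩
      · exact ⟨x, by omega, by omega, e⟩
    · rintro ⟨x, h1, h2, e⟩
      rcases Nat.eq_or_lt_of_le h1 with rfl | h1
      · exact Or.inl e
      · exact Or.inr ⟨x, h1, by omega, e⟩

lemma containsTarget_sound {p : ℕ} (E : List (Fin 14 × Fin 14)) (h : containsTarget A p E = true) :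
    ∀ e ∈ E, Mem A (digit p e.1.val) (digit p e.2.val) := by
  induction E with
  | nil => simp
  | cons e E ih =>
    obtain ⟨h1, h2⟩ := sel_eq_true (show sel (Nat.testBit A (pos (digit p e.1.val)
      (digit p e.2.val))) (containsTarget A p E) false = true from h)
    intro x hx
    rcases List.mem_cons.1 hx with rfl | hx
    · exact h1
    · exact ih h2 x hx

/-- A bijective homomorphism between regular graphs of the same degree is an isomorphism. -/
noncomputable def isoOfRegular {W : Type*} {T : SimpleGraph W} {d : ℕ} (hd : d ≠ 0)
    (hT : ∀ x, (T.neighborSet x).ncard = d) (hG : ∀ v, (G.neighborSet v).ncard = d)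
    (e : W ≃ V) (he : ∀ x y, T.Adj x y → G.Adj (e x) (e y)) : T ≃g G where
  toEquiv := e
  map_rel_iff' := by
    intro x y
    refine ⟨fun h => ?_, he x y⟩
    have h1 : e '' T.neighborSet x = G.neighborSet (e x) := by
      apply Set.eq_of_subset_of_ncard_le
      · rintro _ ⟨z, hz, rfl⟩
        exact he x z hz
      · rw [hG, Set.ncard_image_of_injective _ e.injective, hT]
      -- `ncard` is 0 on infinite sets, so `d ≠ 0` is what gives finiteness.
      · exact Set.finite_of_ncard_ne_zero (by rwa [hG])
    have h2 : e y ∈ G.neighborSet (e x) := h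
    rw [← h1] at h2
    obtain ⟨z, hz, hzy⟩ := h2
    rwa [← e.injective hzy]

lemma targetPairs_cases (P : List (Fin 14 × Fin 14) → Prop) (h0 : P pairsG141) (h1 : P pairsG142)
    (h2 : P pairsG143) (h3 : P pairsPetersen) (t : ℕ) : P (targetPairs t) := by
  match t with
  | 0 => exact h0
  | 1 => exact h1
  | 2 => exact h2
  | _ + 3 => exact h3

lemma graphOfPairs_adj {E : List (Fin 14 × Fin 14)} {x y : Fin 14} :
    (graphOfPairs E).Adj x y ↔ x ≠ y ∧ ((x, y) ∈ E ∨ (y, x) ∈ E) :=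
  SimpleGraph.fromRel_adj _ _ _

instance (E : List (Fin 14 × Fin 14)) : DecidableRel (graphOfPairs E).Adj := fun _ _ =>
  decidable_of_iff' _ graphOfPairs_adj

lemma ncard_neighborSet_target (t : ℕ) :
    ∀ x, ((graphOfPairs (targetPairs t)).neighborSet x).ncard = 3 := by
  have key : ∀ x, (Finset.univ.filter fun y => (graphOfPairs (targetPairs t)).Adj x y).card = 3 :=
    targetPairs_cases (fun E => ∀ x, (Finset.univ.filter fun y => (graphOfPairs E).Adj x y).card = 3)
      (by decide +kernel) (by decide +kernel) (by decide +kernel) (by decide +kernel) t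
  intro x
  rw [← key x, ← Set.ncard_coe_finset]
  congr 1
  ext y
  simp

lemma Inv.exists_iso [Fintype V] (hV : Fintype.card V = 14) (h : Inv G A N f)
    (hG : ∀ v, (G.neighborSet v).ncard = 3) {p t : ℕ} (hp : coversAll p 14 0 0 = true)
    (ht : containsTarget A p (targetPairs t) = true) :
    Nonempty (graphOfPairs (targetPairs t) ≃g G) := by
  have hp := coversAll_sound 14 0 0 hp
  have lt : ∀ x : Fin 14, digit p x < 14 := fun x => (hp _).2 (Or.inr ⟨x, by omega, by omega, rfl⟩)
  let φ : Fin 14 → V := fun x => f (digit p x)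
  have hs : Function.Surjective φ := by
    intro v
    obtain ⟨b, hb, rfl⟩ := h.surj v
    rcases (hp b).1 hb with hb | ⟨x, _, h2, e⟩
    · simp at hb
    · exact ⟨⟨x, by omega⟩, congrArg f e⟩
  have hb : Function.Bijective φ :=
    (Fintype.bijective_iff_surjective_and_card φ).2 ⟨hs, by rw [hV, Fintype.card_fin]⟩
  refine ⟨isoOfRegular (by norm_num) (ncard_neighborSet_target t) hG (Equiv.ofBijective φ hb) ?_⟩
  intro x y hxy
  rw [graphOfPairs_adj] at hxy
  -- Membership in `A` also allows equality, which injectivity of the relabelling rules out.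
  have hne : φ x ≠ φ y := fun e => hxy.1 (hb.1 e)
  have hE := containsTarget_sound _ ht
  change G.Adj (φ x) (φ y)
  rcases hxy.2 with he | he
  · have k : Mem A (digit p x) (digit p y) := hE (x, y) he
    exact (h.adj _ (lt x) _ (lt y) k).resolve_left hne
  · have k : Mem A (digit p y) (digit p x) := hE (y, x) he
    exact (h.adj _ (lt y) _ (lt x) k).symm.resolve_left hne

/-- Leaves ending in a component or a dominating set are vacuous, since their tests cannot succeed
for this `G`. Only target leaves yield the conclusion, and branching passes it upwards. The unread
rest `c'` of the certificate plays no role. -/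
theorem search_sound [Fintype V] (hV : Fintype.card V = 14)
    (hG : ∀ v, (G.neighborSet v).ncard = 3) (hC : G.Connected)
    (hD : ∀ S : Finset V, G.IsDominatingSet S → 5 ≤ S.card) {girth : ℕ}
    (hT : 1 ≤ girth → ∀ a b c, G.Adj a b → G.Adj b c → ¬ G.Adj a c)
    (hS : 2 ≤ girth → ∀ a b c d, G.Adj a b → G.Adj b c → G.Adj c d → a ≠ c → b ≠ d → ¬ G.Adj d a)
    (fuel : ℕ) : ∀ A N c c', search girth fuel A N c = some c' → ∀ f, Inv G A N f →
      ∃ t, Nonempty (graphOfPairs (targetPairs t) ≃g G) := by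
  induction fuel with
  | zero => intro A N c c' h; cases h
  | succ k ih =>
    intro A N c c' hs f h
    cases c with
    | nil => cases hs
    | cons n r =>
      have step : search girth (k + 1) A N (n :: r) =
          force (Nat.land n 15) fun d =>
            sel (Nat.beq d 0) (search girth k A N r)
              (sel (Nat.beq d 15)
                (force (digit n 1) fun e =>
                  sel (Nat.beq e 14)
                    (force (Nat.shiftRight n 8) fun m' => force (Nat.land m' 65535) fun m =>
                      sel (Nat.beq m 0) none (sel (Nat.ble 16383 m) none
                        (sel (isComponent A N m 14 0)
                          (force (Nat.shiftRight m' 16) fun n' => some (n' :: r)) none)))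
                    (sel (Nat.beq e 15)
                      (force (Nat.shiftRight n 12) fun p =>
                        sel (coversAll p 14 0 0)
                          (sel (containsTarget A p (targetPairs (digit n 2)))
                            (force (Nat.shiftRight p 56) fun n' => some (n' :: r)) none)
                          none)
                      (sel (isDominated A n)
                        (force (Nat.shiftRight n 20) fun n' => some (n' :: r)) none)))
                (force (Nat.pred d) fun u =>
                  sel (atMostThree (row A u))
                    (force (nearby girth A u) fun U =>
                      force (Nat.shiftRight n 4) fun n' =>
                        tryEdges (search girth k) A u U 14 0 N (n' :: r))
                    none)) := rfl
      rw [step] at hs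
      simp only [force_eq] at hs
      rcases sel_eq_some hs with ⟨_, hs⟩ | ⟨hd0, hs⟩
      · exact ih _ _ _ _ hs f h
      rcases sel_eq_some hs with ⟨_, hs⟩ | ⟨hd15, hs⟩
      · rcases sel_eq_some hs with ⟨_, hs⟩ | ⟨_, hs⟩
        · rcases sel_eq_some hs with ⟨_, hs⟩ | ⟨h0, hs⟩
          · cases hs
          rcases sel_eq_some hs with ⟨_, hs⟩ | ⟨h1, hs⟩
          · cases hs
          rcases sel_eq_some hs with ⟨h2, _⟩ | ⟨_, hs⟩
          · rw [h.not_isComponent hC (fun e => by rw [e] at h0; cases h0)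
              (by
                by_contra hc
                rw [Nat.ble_eq_true_of_le (not_lt.1 hc)] at h1
                cases h1)] at h2
            cases h2
          · cases hs
        · rcases sel_eq_some hs with ⟨_, hs⟩ | ⟨_, hs⟩
          · rcases sel_eq_some hs with ⟨h1, hs⟩ | ⟨_, hs⟩
            · rcases sel_eq_some hs with ⟨h2, hs⟩ | ⟨_, hs⟩
              · exact ⟨_, h.exists_iso hV hG h1 h2⟩
              · cases hs
            · cases hs
          · rcases sel_eq_some hs with ⟨h2, _⟩ | ⟨_, hs⟩
            · rw [h.not_isDominated hD] at h2; cases h2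
            · cases hs
      · rcases sel_eq_some hs with ⟨h3, hs⟩ | ⟨_, hs⟩
        · have hlt : Nat.land n 15 < 16 :=
            lt_of_le_of_lt (Nat.and_le_right (n := n) (m := 15)) (by norm_num)
          have h15 : Nat.land n 15 ≠ 15 := fun e => by rw [e] at hd15; cases hd15
          have h0 : Nat.land n 15 ≠ 0 := fun e => by rw [e] at hd0; cases hd0
          have hu : Nat.pred (Nat.land n 15) < 14 := by rw [Nat.pred_eq_sub_one]; omega
          exact tryEdges_sound hG ih hu h3
            (fun N f h' j hj => h'.mem_of_nearby hT hS hu hj) 14 0 N _ c' f rfl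
            (by simp) h hs
        · cases hs

end CubicSearch

namespace CubicSearch

variable {V : Type*}

/-! ### The initial states of the search -/

set_option exponentiation.threshold 300 in
lemma mem_diag {i j : ℕ} (hj : j < 14) : Mem diag i j ↔ i < 14 ∧ i = j := by
  by_cases hi : i < 14
  · have key : ∀ i < 14, ∀ j < 14, Nat.testBit diag (pos i j) = decide (i = j) := by
      decide +kernel
    rw [Mem, key i hi j hj, decide_eq_true_eq]
    exact (and_iff_right hi).symm
  -- 288 is `pos 14 0`, the first position after the fourteen rows.
  · have h1 : diag < 2 ^ 288 := by decide +kernel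
    rw [Mem, Nat.testBit_lt_two_pow (lt_of_lt_of_le h1
      (Nat.pow_le_pow_right (by norm_num) (by rw [pos_eq]; omega)))]
    simp [hi]

/-- Any injective choice of vertices for some labels extends to a full labelling, so a given
triangle or 4-cycle may be assumed to carry the labels 0, 1, 2 or 0, 1, 2, 3. -/
lemma exists_inv_diag [Fintype V] (G : SimpleGraph V) (hV : Fintype.card V = 14) (s : Finset (Fin 14))
    (g : Fin 14 → V) (hg : Set.InjOn g s) :
    ∃ f : ℕ → V, Inv G diag diag f ∧ ∀ i ∈ s, f i.val = g i := by
  classical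
  obtain ⟨e, he⟩ := Finset.exists_equiv_extend_of_card_eq (t := (Finset.univ : Finset V))
    (by rw [Fintype.card_fin, Finset.card_univ, hV]) (Finset.subset_univ (s.image g)) hg
  let f : ℕ → V := fun n => if h : n < 14 then (e ⟨n, h⟩ : V) else e 0
  have hf : ∀ n (h : n < 14), f n = e ⟨n, h⟩ := fun n h => dif_pos h
  refine ⟨f, ⟨?_, ?_, ?_, ?_, ?_, ?_, ?_, ?_, ?_⟩, fun i hi => ?_⟩
  · intro i hi j hj h
    rw [hf i hi, hf j hj] at h
    simpa using e.injective (Subtype.ext h)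
  · intro v
    obtain ⟨i, hi⟩ := e.surjective ⟨v, Finset.mem_univ v⟩
    exact ⟨i, i.2, by rw [hf i i.2]; exact congrArg Subtype.val hi⟩
  · exact fun i j hj h => ((mem_diag hj).1 h).1
  · exact fun i hi => (mem_diag hi).2 ⟨hi, rfl⟩
  · exact fun i hi => (mem_diag hi).2 ⟨hi, rfl⟩
  · exact fun i hi j hj h => (mem_diag hi).2 ⟨hj, ((mem_diag hj).1 h).2.symm⟩
  · exact fun i hi j hj h => (mem_diag hi).2 ⟨hj, ((mem_diag hj).1 h).2.symm⟩
  · exact fun i hi j hj h => Or.inl (congrArg f ((mem_diag hj).1 h).2)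
  · exact fun i hi j hj h _ => h
  · rw [hf i i.2]; exact he i hi

noncomputable def startTriangle : ℕ := setPair (setPair (setPair diag 0 1) 0 2) 1 2

noncomputable def startSquare : ℕ := setPair (setPair (setPair (setPair diag 0 1) 1 2) 2 3) 3 0

lemma closes_girthFive : closes 2 diag diag stepsGirthFive = true := by decide +kernel

lemma closes_square : closes 1 startSquare startSquare stepsSquare = true := by decide +kernel

lemma closes_triangle : closes 0 startTriangle startTriangle stepsTriangle = true := by
  decide +kernel

lemma exists_of_closes {girth A N : ℕ} {c : List ℕ} (h : closes girth A N c = true) :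
    ∃ c', search girth 64 A N c = some c' := by
  cases hs : search girth 64 A N c with
  | none => rw [closes, hs] at h; cases h
  | some c' => exact ⟨c', rfl⟩

theorem exists_iso_target [Fintype V] (G : SimpleGraph V) (hV : Fintype.card V = 14)
    (hG : ∀ v, (G.neighborSet v).ncard = 3) (hC : G.Connected)
    (hD : ∀ S : Finset V, G.IsDominatingSet S → 5 ≤ S.card) :
    ∃ t, Nonempty (graphOfPairs (targetPairs t) ≃g G) := by
  have pair : ∀ {A N : ℕ} {f : ℕ → V} (i j : ℕ), i < 14 → j < 14 → Inv G A N f →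
      G.Adj (f i) (f j) → Inv G (setPair A i j) (setPair N i j) f :=
    fun i j hi hj h a => h.add_pair hi hj (Or.inr a)
  by_cases hT : ∀ a b c, G.Adj a b → G.Adj b c → ¬ G.Adj a c
  swap
  · push Not at hT
    obtain ⟨a, b, c, hab, hbc, hac⟩ := hT
    -- Only the entries at 0, 1 and 2 matter; the repeated `a` is padding.
    obtain ⟨f, hf, hfg⟩ := exists_inv_diag G hV {0, 1, 2} (![a, b, c, a, a, a, a, a, a, a, a, a, a, a])
      (by
        intro i hi j hj
        have h1 := hab.ne
        have h2 := hbc.ne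
        have h3 := hac.ne
        simp only [Finset.coe_insert, Finset.coe_singleton, Set.mem_insert_iff,
          Set.mem_singleton_iff] at hi hj
        rcases hi with rfl | rfl | rfl <;> rcases hj with rfl | rfl | rfl <;>
          simp [h1, h2, h3, h1.symm, h2.symm, h3.symm])
    have f0 : f 0 = a := hfg 0 (by simp)
    have f1 : f 1 = b := hfg 1 (by simp)
    have f2 : f 2 = c := hfg 2 (by simp)
    obtain ⟨c', hc⟩ := exists_of_closes closes_triangle
    refine search_sound hV hG hC hD (by simp) (by simp) 64 _ _ _ _ hc f ?_
    refine pair 1 2 (by norm_num) (by norm_num) (pair 0 2 (by norm_num) (by norm_num)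
      (pair 0 1 (by norm_num) (by norm_num) hf ?_) ?_) ?_
    · rwa [f0, f1]
    · rwa [f0, f2]
    · rwa [f1, f2]
  by_cases hS : ∀ a b c d, G.Adj a b → G.Adj b c → G.Adj c d → a ≠ c → b ≠ d → ¬ G.Adj d a
  swap
  · push Not at hS
    obtain ⟨a, b, c, d, hab, hbc, hcd, hac, hbd, hda⟩ := hS
    obtain ⟨f, hf, hfg⟩ := exists_inv_diag G hV {0, 1, 2, 3}
      (![a, b, c, d, a, a, a, a, a, a, a, a, a, a])
      (by
        intro i hi j hj
        have h1 := hab.ne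
        have h2 := hbc.ne
        have h3 := hcd.ne
        have h4 := hda.ne
        simp only [Finset.coe_insert, Finset.coe_singleton, Set.mem_insert_iff,
          Set.mem_singleton_iff] at hi hj
        rcases hi with rfl | rfl | rfl | rfl <;> rcases hj with rfl | rfl | rfl | rfl <;>
          simp [h1, h2, h3, h4, hac, hbd, h1.symm, h2.symm, h3.symm, h4.symm, hac.symm, hbd.symm])
    have f0 : f 0 = a := hfg 0 (by simp)
    have f1 : f 1 = b := hfg 1 (by simp)
    have f2 : f 2 = c := hfg 2 (by simp)
    have f3 : f 3 = d := hfg 3 (by simp)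
    obtain ⟨c', hc⟩ := exists_of_closes closes_square
    refine search_sound hV hG hC hD (fun _ => hT) (by simp) 64 _ _ _ _ hc f ?_
    refine pair 3 0 (by norm_num) (by norm_num) (pair 2 3 (by norm_num) (by norm_num)
      (pair 1 2 (by norm_num) (by norm_num) (pair 0 1 (by norm_num) (by norm_num) hf ?_) ?_) ?_) ?_
    · rwa [f0, f1]
    · rwa [f1, f2]
    · rwa [f2, f3]
    · rwa [f3, f0]
  have v0 : V := (Fintype.card_pos_iff.1 (by rw [hV]; norm_num)).some
  obtain ⟨f, hf, -⟩ := exists_inv_diag G hV ∅ (fun _ => v0) (by simp)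
  obtain ⟨c', hc⟩ := exists_of_closes closes_girthFive
  exact search_sound hV hG hC hD (fun _ => hT) (fun _ => hS) 64 _ _ _ _ hc f hf

end CubicSearch

namespace CubicSearch

variable {V W : Type*}

/-! ### Properties of the four graphs -/

/-- The closed adjacency matrix of a graph given by its edges. -/
def closedMatrix (E : List (Fin 14 × Fin 14)) : ℕ := E.foldl (fun M e => setPair M e.1 e.2) diag

/-- Turns adjacency in an explicit graph into a bit test on one number, which the kernel evaluates
quickly in the checks that follow. -/
lemma mem_closedMatrix {E : List (Fin 14 × Fin 14)} (x y : Fin 14) :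
    Mem (closedMatrix E) x y ↔ CAdj (graphOfPairs E) x y := by
  have key : ∀ (E : List (Fin 14 × Fin 14)) (M : ℕ),
      Mem (E.foldl (fun M e => setPair M e.1 e.2) M) x y ↔
        Mem M x y ∨ (x, y) ∈ E ∨ (y, x) ∈ E := by
    intro E
    induction E with
    | nil => simp
    | cons e E ih =>
      intro M
      rw [List.foldl_cons, ih, mem_setPair e.2.2 e.1.2 y.2]
      simp only [List.mem_cons, Prod.ext_iff, Fin.ext_iff]
      constructor
      · rintro ((h | ⟨h1, h2⟩ | ⟨h1, h2⟩) | h | h)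
        · exact Or.inl h
        · exact Or.inr (Or.inl (Or.inl ⟨h1.symm, h2.symm⟩))
        · exact Or.inr (Or.inr (Or.inl ⟨h2.symm, h1.symm⟩))
        · exact Or.inr (Or.inl (Or.inr h))
        · exact Or.inr (Or.inr (Or.inr h))
      · rintro (h | (⟨h1, h2⟩ | h) | (⟨h1, h2⟩ | h))
        · exact Or.inl (Or.inl h)
        · exact Or.inl (Or.inr (Or.inl ⟨h1.symm, h2.symm⟩))
        · exact Or.inr (Or.inl h)
        · exact Or.inl (Or.inr (Or.inr ⟨h2.symm, h1.symm⟩))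
        · exact Or.inr (Or.inr h)
  rw [closedMatrix, key, mem_diag y.2, CAdj, graphOfPairs_adj, ← Fin.ext_iff]
  have := x.2
  tauto

/-- A vertex and three further vertices of a graph with matrix `M` never cover everything, if the
first of them is in the closed neighbourhood of `0`. -/
def NoCover (M : ℕ) : Prop :=
  ∀ a < 14, Nat.testBit M (pos 0 a) = true → ∀ b < 14, ∀ c < 14, ∀ d < 14,
    Nat.beq (Nat.lor (Nat.lor (row M a) (row M b)) (Nat.lor (row M c) (row M d))) 16383 = false

instance (M : ℕ) : Decidable (NoCover M) := by unfold NoCover; infer_instance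

/-- A smaller dominating set can be enlarged to four elements, one of which lies in the closed
neighbourhood of 0. Choosing that one first leaves about `4 * 14 ^ 3` quadruples in a cubic graph
instead of `14 ^ 4`. -/
lemma five_le_card {E : List (Fin 14 × Fin 14)} (hE : NoCover (closedMatrix E))
    (S : Finset (Fin 14)) (hS : (graphOfPairs E).IsDominatingSet S) : 5 ≤ S.card := by
  by_contra hc
  obtain ⟨T, hST, -, hT⟩ := Finset.exists_subsuperset_card_eq (Finset.subset_univ S)
    (show S.card ≤ 4 by omega) (by simp)
  have hdom : ∀ v, ∃ w ∈ T, CAdj (graphOfPairs E) w v := by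
    intro v
    by_cases hv : v ∈ S
    · exact ⟨v, hST hv, Or.inl rfl⟩
    · obtain ⟨w, hw, h⟩ := hS v hv
      exact ⟨w, hST hw, Or.inr h.symm⟩
  obtain ⟨a, ha, h0⟩ := hdom 0
  have h3 : (T.erase a).card = 3 := by rw [Finset.card_erase_of_mem ha, hT]
  obtain ⟨b, c, d, -, -, -, he⟩ := Finset.card_eq_three.1 h3
  have h := hE a a.2 ((mem_closedMatrix 0 a).2 h0.symm) b b.2 c c.2 d d.2
  rw [Bool.eq_false_iff] at h
  refine h (beq_iff.2 (Nat.eq_of_testBit_eq fun i => ?_))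
  by_cases hi : i < 14
  · have hT' : ∀ w ∈ T, w = a ∨ w = b ∨ w = c ∨ w = d := by
      intro w hw
      by_cases hwa : w = a
      · exact Or.inl hwa
      · have : w ∈ T.erase a := Finset.mem_erase.2 ⟨hwa, hw⟩
        rw [he] at this
        simpa using Or.inr this
    obtain ⟨w, hw, hwi⟩ := hdom ⟨i, hi⟩
    have hm : Nat.testBit (closedMatrix E) (pos w i) = true := (mem_closedMatrix w ⟨i, hi⟩).2 hwi
    simp only [testBit_lor, testBit_row hi, testBit_full, hi, decide_true, Bool.or_eq_true]
    rcases hT' w hw with rfl | rfl | rfl | rfl <;> simp [hm]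
  -- Rows have no bits from 14 on, and neither does 16383.
  · have hz : ∀ j, Nat.testBit (row (closedMatrix E) j) i = false := fun j =>
      Nat.testBit_lt_two_pow (lt_of_lt_of_le (row_lt _ j)
        (Nat.pow_le_pow_right (by norm_num) (not_lt.1 hi)))
    simp [testBit_full, hz, hi]

lemma five_le_card_target (t : ℕ) :
    ∀ S, (graphOfPairs (targetPairs t)).IsDominatingSet S → 5 ≤ S.card :=
  targetPairs_cases (fun E => ∀ S, (graphOfPairs E).IsDominatingSet S → 5 ≤ S.card)
    (five_le_card (by decide +kernel)) (five_le_card (by decide +kernel))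
    (five_le_card (by decide +kernel)) (five_le_card (by decide +kernel)) t

instance (E : List (Fin 14 × Fin 14)) (S : Finset (Fin 14)) :
    Decidable ((graphOfPairs E).IsDominatingSet S) := by
  unfold SimpleGraph.IsDominatingSet; infer_instance

lemma exists_dominating_target (t : ℕ) :
    ∃ S, (graphOfPairs (targetPairs t)).IsDominatingSet S ∧ S.card = 5 :=
  targetPairs_cases (fun E => ∃ S, (graphOfPairs E).IsDominatingSet S ∧ S.card = 5)
    ⟨{0, 1, 2, 4, 13}, by decide +kernel, rfl⟩ ⟨{0, 1, 2, 3, 11}, by decide +kernel, rfl⟩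
    ⟨{0, 1, 2, 6, 11}, by decide +kernel, rfl⟩ ⟨{0, 1, 2, 11, 12}, by decide +kernel, rfl⟩ t

/-- A walk `0, a, b, c, x` with repetitions allowed, searched from both ends towards the middle
vertex `b`. Distance at most four from 0 suffices for all four graphs. -/
lemma connected_of_eccentricity_le {E : List (Fin 14 × Fin 14)}
    (h : ∀ x : Fin 14, ∃ a : Fin 14, Mem (closedMatrix E) 0 a ∧ ∃ c : Fin 14,
      Mem (closedMatrix E) x c ∧ ∃ b : Fin 14, Mem (closedMatrix E) a b ∧
        Mem (closedMatrix E) c b) : (graphOfPairs E).Connected := by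
  have reach : ∀ x y : Fin 14, Mem (closedMatrix E) x y → (graphOfPairs E).Reachable x y := by
    intro x y hxy
    rcases (mem_closedMatrix x y).1 hxy with rfl | h
    · exact SimpleGraph.Reachable.refl _
    · exact h.reachable
  have all : ∀ x, (graphOfPairs E).Reachable 0 x := by
    intro x
    obtain ⟨a, h1, c, h2, b, h3, h4⟩ := h x
    exact (((reach 0 a h1).trans (reach a b h3)).trans (reach c b h4).symm).trans (reach x c h2).symm
  exact { preconnected := fun x y => (all x).symm.trans (all y), nonempty := ⟨0⟩ }

instance (M i j : ℕ) : Decidable (Mem M i j) := by unfold Mem; infer_instance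

lemma connected_target (t : ℕ) : (graphOfPairs (targetPairs t)).Connected :=
  targetPairs_cases (fun E => (graphOfPairs E).Connected)
    (connected_of_eccentricity_le (by decide +kernel))
    (connected_of_eccentricity_le (by decide +kernel))
    (connected_of_eccentricity_le (by decide +kernel))
    (connected_of_eccentricity_le (by decide +kernel)) t

lemma isDominatingSet_map {G : SimpleGraph V} {H : SimpleGraph W} (e : G ≃g H) {S : Finset V}
    (hS : G.IsDominatingSet S) : H.IsDominatingSet (S.map e.toEquiv.toEmbedding) := by
  intro w hw
  obtain ⟨u, hu, h⟩ := hS (e.symm w) fun hm => hw (Finset.mem_map.2 ⟨_, hm, e.apply_symm_apply w⟩)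
  refine ⟨e u, Finset.mem_map.2 ⟨u, hu, rfl⟩, ?_⟩
  have := e.map_rel_iff.2 h
  rwa [e.apply_symm_apply] at this

lemma dominationNumber_congr {G : SimpleGraph V} {H : SimpleGraph W} (e : G ≃g H) :
    G.dominationNumber = H.dominationNumber := by
  unfold SimpleGraph.dominationNumber
  congr 1
  ext k
  constructor
  · rintro ⟨S, hS, rfl⟩
    exact ⟨_, isDominatingSet_map e hS, Finset.card_map _⟩
  · rintro ⟨S, hS, rfl⟩
    exact ⟨_, isDominatingSet_map e.symm hS, Finset.card_map _⟩

lemma dominationNumber_target (t : ℕ) : (graphOfPairs (targetPairs t)).dominationNumber = 5 := by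
  apply le_antisymm
  · exact Nat.sInf_le (exists_dominating_target t)
  · apply le_csInf ⟨5, exists_dominating_target t⟩
    rintro k ⟨S, hS, rfl⟩
    exact five_le_card_target t S hS

/-! ### The invariant that separates the four graphs -/

/-- The vertices that lie on a 4-cycle. -/
def squareVertices (G : SimpleGraph V) : Set V :=
  {v | ∃ a, G.Adj v a ∧ ∃ b, G.Adj a b ∧ v ≠ b ∧ ∃ c, G.Adj b c ∧ a ≠ c ∧ G.Adj c v}

lemma squareVertices_subset_preimage {G : SimpleGraph V} {H : SimpleGraph W} (e : G ≃g H) :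
    squareVertices G ⊆ e ⁻¹' squareVertices H := by
  rintro v ⟨a, h1, b, h2, hn, c, h3, hn', h4⟩
  exact ⟨e a, e.map_rel_iff.2 h1, e b, e.map_rel_iff.2 h2, e.injective.ne hn, e c,
    e.map_rel_iff.2 h3, e.injective.ne hn', e.map_rel_iff.2 h4⟩

lemma ncard_squareVertices_congr {G : SimpleGraph V} {H : SimpleGraph W} (e : G ≃g H) :
    (squareVertices G).ncard = (squareVertices H).ncard := by
  have h : squareVertices G = e ⁻¹' squareVertices H := by
    refine Set.Subset.antisymm (squareVertices_subset_preimage e) fun v hv => ?_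
    have := squareVertices_subset_preimage e.symm hv
    simpa using this
  rw [h, ← Set.ncard_image_of_injective _ e.injective, Set.image_preimage_eq _ e.surjective]

/-- Each condition stands directly after the quantifier it restricts, so that the decision procedure
follows edges instead of running through all quadruples. -/
lemma ncard_squareVertices {E : List (Fin 14 × Fin 14)} {k : ℕ}
    (h : (Finset.univ.filter fun v : Fin 14 =>
      ∃ a : Fin 14, (v ≠ a ∧ Mem (closedMatrix E) v a) ∧
      ∃ b : Fin 14, (a ≠ b ∧ Mem (closedMatrix E) a b) ∧ v ≠ b ∧
      ∃ c : Fin 14, (b ≠ c ∧ Mem (closedMatrix E) b c) ∧ a ≠ c ∧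
        (c ≠ v ∧ Mem (closedMatrix E) c v)).card = k) :
    (squareVertices (graphOfPairs E)).ncard = k := by
  have key : ∀ x y : Fin 14, (x ≠ y ∧ Mem (closedMatrix E) x y) ↔ (graphOfPairs E).Adj x y := by
    intro x y
    rw [mem_closedMatrix, CAdj]
    exact ⟨fun h => h.2.resolve_left h.1, fun h => ⟨h.ne, Or.inr h⟩⟩
  rw [← h, ← Set.ncard_coe_finset]
  congr 1
  ext v
  simp only [key, Finset.coe_filter, Finset.mem_univ, true_and]
  rfl

lemma ncard_squareVertices_G141 : (squareVertices graphG141).ncard = 14 :=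
  ncard_squareVertices (E := pairsG141) (by decide +kernel)

lemma ncard_squareVertices_G142 : (squareVertices graphG142).ncard = 12 :=
  ncard_squareVertices (E := pairsG142) (by decide +kernel)

lemma ncard_squareVertices_G143 : (squareVertices graphG143).ncard = 8 :=
  ncard_squareVertices (E := pairsG143) (by decide +kernel)

instance : DecidableRel (generalizedPetersen 7 2).Adj := fun _ _ =>
  decidable_of_iff' _ (SimpleGraph.fromRel_adj _ _ _)

/-- `ZMod 7` unfolds to `Fin 7`; labels below 7 become outer vertices, and `7 + i` becomes the inner
vertex `i`. -/
def petersenEquiv : Fin 14 ≃ ZMod 7 ⊕ ZMod 7 := (finSumFinEquiv (m := 7) (n := 7)).symm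

/-- `pairsPetersen` describes the generalized Petersen graph. -/
def petersenIso : graphOfPairs pairsPetersen ≃g generalizedPetersen 7 2 where
  toEquiv := petersenEquiv
  map_rel_iff' := by
    have : ∀ a b : Fin 14, (generalizedPetersen 7 2).Adj (petersenEquiv a) (petersenEquiv b) ↔
        (graphOfPairs pairsPetersen).Adj a b := by
      decide +kernel
    exact fun {a b} => this a b

lemma ncard_squareVertices_petersen : (squareVertices (generalizedPetersen 7 2)).ncard = 0 := by
  rw [← ncard_squareVertices_congr petersenIso]
  exact ncard_squareVertices (E := pairsPetersen) (by decide +kernel)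

lemma ncard_neighborSet_eq_degree (G : SimpleGraph V) [G.LocallyFinite] (v : V) :
    (G.neighborSet v).ncard = G.degree v := by
  rw [← SimpleGraph.card_neighborSet_eq_degree, ← Nat.card_coe_set_eq, Nat.card_eq_fintype_card]

lemma properties_of_iso_target {G : SimpleGraph V} [Fintype V] [G.LocallyFinite] {t : ℕ}
    (e : G ≃g graphOfPairs (targetPairs t)) :
    G.Connected ∧ G.IsRegularOfDegree 3 ∧ Fintype.card V = 14 ∧ G.dominationNumber = 5 := by
  refine ⟨e.connected_iff.2 (connected_target t), fun v => ?_, ?_, ?_⟩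
  · rw [← ncard_neighborSet_eq_degree, ← ncard_neighborSet_target t (e v),
      ← Set.ncard_image_of_injective _ e.injective]
    congr 1
    ext w
    constructor
    · rintro ⟨u, hu, rfl⟩
      exact e.map_rel_iff.2 hu
    · intro hw
      refine ⟨e.symm w, ?_, e.apply_symm_apply w⟩
      have hw : (graphOfPairs (targetPairs t)).Adj (e v) w := hw
      rw [← e.apply_symm_apply w] at hw
      exact e.map_rel_iff.1 hw
  · rw [Fintype.card_congr e.toEquiv, Fintype.card_fin]
  · rw [dominationNumber_congr e, dominationNumber_target]

end CubicSearch

/-! ### The classification theorem -/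

open CubicSearch in
theorem theorem5p2 :
    (∀ {V : Type*} [Fintype V] (G : SimpleGraph V) [G.LocallyFinite],
      (G.Connected ∧ G.IsRegularOfDegree 3 ∧ Fintype.card V = 14 ∧ G.dominationNumber = 5) ↔
        (Nonempty (G ≃g graphG141) ∨ Nonempty (G ≃g graphG142) ∨ Nonempty (G ≃g graphG143) ∨
          Nonempty (G ≃g generalizedPetersen 7 2))) ∧
    IsEmpty (graphG141 ≃g graphG142) ∧
    IsEmpty (graphG141 ≃g graphG143) ∧
    IsEmpty (graphG141 ≃g generalizedPetersen 7 2) ∧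
    IsEmpty (graphG142 ≃g graphG143) ∧
    IsEmpty (graphG142 ≃g generalizedPetersen 7 2) ∧
    IsEmpty (graphG143 ≃g generalizedPetersen 7 2) := by
  refine ⟨fun {V} _ G _ => ⟨?_, ?_⟩, ?_, ?_, ?_, ?_, ?_, ?_⟩
  · rintro ⟨hC, hR, hV, hD⟩
    obtain ⟨t, ⟨e⟩⟩ := exists_iso_target G hV
      (fun v => (ncard_neighborSet_eq_degree G v).trans (hR v)) hC
      -- Only γ ≥ 5 enters here: a connected cubic graph of order 14 without a dominating set of at
      -- most four vertices is already a target.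
      fun S hS => hD ▸ Nat.sInf_le ⟨S, hS, rfl⟩
    match t, e with
    | 0, e => exact Or.inl ⟨e.symm⟩
    | 1, e => exact Or.inr (Or.inl ⟨e.symm⟩)
    | 2, e => exact Or.inr (Or.inr (Or.inl ⟨e.symm⟩))
    -- `targetPairs` sends every index from 3 on to the Petersen list.
    | _ + 3, e => exact Or.inr (Or.inr (Or.inr ⟨e.symm.trans petersenIso⟩))
  · rintro (⟨⟨e⟩⟩ | ⟨⟨e⟩⟩ | ⟨⟨e⟩⟩ | ⟨⟨e⟩⟩)
    · exact properties_of_iso_target (t := 0) e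
    · exact properties_of_iso_target (t := 1) e
    · exact properties_of_iso_target (t := 2) e
    · exact properties_of_iso_target (t := 3) (e.trans petersenIso.symm)
  -- An isomorphism would equate two of the distinct numbers 14, 12, 8 and 0.
  all_goals
    refine ⟨fun e => ?_⟩
    have h := ncard_squareVertices_congr e
    simp only [ncard_squareVertices_G141, ncard_squareVertices_G142, ncard_squareVertices_G143,
      ncard_squareVertices_petersen] at h
    omega
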